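/- Let $L>0$ and let $\kappa,\gamma,B\in\mathbb{R}$ satisfy $\kappa+\gamma B^3>0$. For $k\in(0,1)$ let $K(k)=\int_0^{\pi/2}\frac{dt}{\sqrt{1-k^2\sin^2t}}$ be the complete elliptic integral of the first kind, let $\mathrm{sn}(\cdot,k)$, $\mathrm{cn}(\cdot,k)$ be the Jacobi elliptic functions of modulus $k$, and put $$a=\frac2L\Big[\big(2-k^2+2\sqrt{k^4-k^2+1}\big)L^2K(k)^2\Big]^{1/4},\qquad q=-1+k^2-\sqrt{k^4-k^2+1},\qquad \omega=\frac{16K(k)^2\sqrt{k^4-k^2+1}}{L^2},$$ $$\varphi(x)=\frac{1}{\sqrt[4]{\kappa+\gamma B^3}}\;\frac{a\,\mathrm{cn}\big(\tfrac{4K(k)}{L}x,k\big)}{\sqrt{1-q\,\mathrm{sn}^2\big(\tfrac{4K(k)}{L}x,k\big)}},\qquad x\in\mathbb{R}.$$ Then: 1. For every $k\in(0,1)$ one has $a\in\big(2\sqrt{\pi/L},+\infty\big)$, $q\in(-2,-1)$ and $\omega\in\big(\tfrac{4\pi^2}{L^2},+\infty\big)$. Moreover $a$ and $\omega$ are $C^\infty$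 functions of $(k,L)\in(0,1)\times(0,\infty)$, and $q$ is a $C^\infty$ function of $k\in(0,1)$. 2. For every $k\in(0,1)$ the function $\varphi$ is an $L$-periodic classical ($C^2$) solution on $\mathbb{R}$ of $$-\varphi''+\omega\varphi-(\kappa+\gamma B^3)\varphi^5=0 .$$ 3. For the fixed $L$, the map $k\mapsto\omega$ is a bijection from $(0,1)$ onto $\big(\tfrac{4\pi^2}{L^2},+\infty\big)$. Writing $\varphi_\omega$ for the solution $\varphi$ whose modulus $k$ corresponds to $\omega$, the map $$\omega\in\big(\tfrac{4\pi^2}{L^2},+\infty\big)\longmapsto\varphi_\omega\in H^2_{\mathrm{per}}([0,L])$$ is well defined and $C^\infty$, where $H^2_{\mathrm{per}}([0,L])$ is the space of complex-valued $L$-periodic $L^2$ functions $f$ with $\|f\|_{H^2}^2=L\sum_{n\in\mathbb{Z}}(1+n^2)^2|\widehat f(n)|^2<\infty$, $\widehat f(n)=\frac1L\int_0^Lf(x)e^{-2\pi inx/L}\,dx$. -/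

import Mathlib

open Set MeasureTheory
open scoped ContDiff

noncomputable section

/-! ### Elliptic integrals and Jacobi elliptic functions (real argument, modulus `k ∈ (0,1)`) -/

/-- The elliptic integral of the first kind
`F(η, k) = ∫_0^η dt / √(1 - k² sin² t)`. -/
def ellipticF (η k : ℝ) : ℝ :=
  ∫ t in (0 : ℝ)..η, 1 / Real.sqrt (1 - k ^ 2 * Real.sin t ^ 2)

/-- The complete elliptic integral of the first kind `K(k) = F(π/2, k)`. -/
def ellipticK (k : ℝ) : ℝ := ellipticF (Real.pi / 2) k

/-- The Jacobi amplitude `am(u, k)`: the inverse of the increasing bijection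
`η ↦ F(η, k)` of the real line (for `0 < k < 1`). -/
def jacobiAm (u k : ℝ) : ℝ := Function.invFun (fun η : ℝ => ellipticF η k) u

/-- The Jacobi elliptic function `sn(u, k) = sin (am(u, k))`. -/
def jacobiSn (u k : ℝ) : ℝ := Real.sin (jacobiAm u k)

/-- The Jacobi elliptic function `cn(u, k) = cos (am(u, k))`. -/
def jacobiCn (u k : ℝ) : ℝ := Real.cos (jacobiAm u k)

/-! ### The cnoidal wave and its parameters -/

/-- The amplitude
`a = (2/L) [ (2 - k² + 2 √(k⁴ - k² + 1)) L² K(k)² ]^{1/4}`. -/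
def cnoidalA (k L : ℝ) : ℝ :=
  2 / L * ((2 - k ^ 2 + 2 * Real.sqrt (k ^ 4 - k ^ 2 + 1)) * L ^ 2 * ellipticK k ^ 2)
    ^ (1 / 4 : ℝ)

/-- The parameter `q = -1 + k² - √(k⁴ - k² + 1)`. -/
def cnoidalQ (k : ℝ) : ℝ := -1 + k ^ 2 - Real.sqrt (k ^ 4 - k ^ 2 + 1)

/-- The frequency `ω = 16 K(k)² √(k⁴ - k² + 1) / L²`. -/
def cnoidalOmega (k L : ℝ) : ℝ :=
  16 * ellipticK k ^ 2 * Real.sqrt (k ^ 4 - k ^ 2 + 1) / L ^ 2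

/-- The cnoidal profile
`φ(x) = (κ + γ B³)^{-1/4} a cn(4K(k)x/L, k) / √(1 - q sn²(4K(k)x/L, k))`. -/
def cnoidalWave (κ γ B L k x : ℝ) : ℝ :=
  1 / (κ + γ * B ^ 3) ^ (1 / 4 : ℝ) *
    (cnoidalA k L * jacobiCn (4 * ellipticK k / L * x) k /
      Real.sqrt (1 - cnoidalQ k * jacobiSn (4 * ellipticK k / L * x) k ^ 2))

/-- `φ` is an `L`-periodic classical (`C²`) solution on the real line of
`-φ'' + w φ - (κ + γ B³) φ⁵ = 0`. -/
def IsPeriodicSolution (κ γ B L w : ℝ) (φ : ℝ → ℝ) : Prop :=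
  Function.Periodic φ L ∧ ContDiff ℝ 2 φ ∧
    ∀ x : ℝ, -deriv (deriv φ) x + w * φ x - (κ + γ * B ^ 3) * φ x ^ 5 = 0

/-! ### The periodic Sobolev space `H²_per([0, L])` -/

section Sobolev

variable (L : ℝ) [Fact (0 < L)]

/-- The complex `L²` space of the circle `ℝ / Lℤ`. -/
abbrev L2per : Type := Lp ℂ 2 (AddCircle.haarAddCircle (T := L))

variable {L}

/-- The weighted Fourier coefficient `√L (1 + n²) f̂(n)`, where
`f̂(n) = (1/L) ∫_0^L f(x) e^{-2πinx/L} dx`. -/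
def h2Coeff (f : L2per L) (n : ℤ) : ℂ :=
  ((Real.sqrt L * (1 + (n : ℝ) ^ 2) : ℝ) : ℂ) * fourierCoeff f n

theorem h2Coeff_add (f g : L2per L) : h2Coeff (f + g) = h2Coeff f + h2Coeff g := by
  funext n
  simp only [h2Coeff, Pi.add_apply, ← fourierBasis_repr, map_add, lp.coeFn_add, mul_add]

theorem h2Coeff_smul (c : ℂ) (f : L2per L) : h2Coeff (c • f) = c • h2Coeff f := by
  funext n
  simp only [h2Coeff, Pi.smul_apply, ← fourierBasis_repr, map_smul, lp.coeFn_smul, smul_eq_mul]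
  ring

theorem h2Coeff_zero : h2Coeff (0 : L2per L) = 0 := by
  simpa using h2Coeff_smul (0 : ℂ) (0 : L2per L)

variable (L)

/-- The subspace of those `f ∈ L²` for which `∑ₙ (1 + n²)² |f̂(n)|² < ∞`. -/
def H2perSubmodule : Submodule ℂ (L2per L) where
  carrier := {f | Memℓp (h2Coeff f) 2}
  zero_mem' := by
    simp only [mem_ofPred_eq, h2Coeff_zero]
    exact zero_memℓp
  add_mem' := by
    intro f g hf hg
    simp only [mem_ofPred_eq, h2Coeff_add] at *
    exact hf.add hg
  smul_mem' := by
    intro c f hf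
    simp only [mem_ofPred_eq, h2Coeff_smul] at *
    exact hf.const_smul c

/-- The periodic Sobolev space `H²_per([0, L])` of complex-valued functions. It is a separate type,
so that it carries its own norm (below) and not the one of `L²`. -/
def H2per : Type := H2perSubmodule L

instance : AddCommGroup (H2per L) := inferInstanceAs (AddCommGroup (H2perSubmodule L))

instance : Module ℂ (H2per L) := inferInstanceAs (Module ℂ (H2perSubmodule L))

variable {L}

/-- The underlying `L²` class of an element of `H²_per`. -/
def H2per.toL2 (f : H2per L) : L2per L := Subtype.val (p := fun g => g ∈ H2perSubmodule L) f

variable (L)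

/-- The map `f ↦ (√L (1 + n²) f̂(n))ₙ` from `H²_per` to `ℓ²(ℤ)`. -/
def H2per.toEll2 : H2per L →ₗ[ℂ] lp (fun _ : ℤ => ℂ) 2 where
  toFun f := ⟨h2Coeff f.toL2, f.2⟩
  map_add' f g := Subtype.ext (h2Coeff_add f.toL2 g.toL2)
  map_smul' c f := Subtype.ext (h2Coeff_smul c f.toL2)

theorem H2per.toEll2_injective : Function.Injective (H2per.toEll2 L) := by
  intro f g h
  have hL : 0 < L := Fact.out
  apply Subtype.ext
  change f.toL2 = g.toL2
  apply (fourierBasis (T := L)).repr.injective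
  ext n
  have h1 : h2Coeff f.toL2 n = h2Coeff g.toL2 n := congrFun (congrArg Subtype.val h) n
  rw [fourierBasis_repr, fourierBasis_repr]
  have hne : ((Real.sqrt L * (1 + (n : ℝ) ^ 2) : ℝ) : ℂ) ≠ 0 := by
    rw [Complex.ofReal_ne_zero]
    positivity
  exact mul_left_cancel₀ hne h1

/-- The norm of `H²_per`, pulled back from `ℓ²`; see `H2per.norm_sq`. -/
instance : NormedAddCommGroup (H2per L) :=
  NormedAddCommGroup.induced (H2per L) (lp (fun _ : ℤ => ℂ) 2) (H2per.toEll2 L)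
    (H2per.toEll2_injective L)

instance : NormedSpace ℂ (H2per L) :=
  NormedSpace.induced ℂ (H2per L) (lp (fun _ : ℤ => ℂ) 2) (H2per.toEll2 L)

/-- `‖f‖²_{H²} = L ∑ₙ (1 + n²)² |f̂(n)|²`. -/
theorem H2per.norm_sq (f : H2per L) :
    ‖f‖ ^ 2 = L * ∑' n : ℤ, (1 + (n : ℝ) ^ 2) ^ 2 * ‖fourierCoeff f.toL2 n‖ ^ 2 := by
  have hL : 0 < L := Fact.out
  have h := lp.norm_rpow_eq_tsum (p := 2) (by norm_num) (H2per.toEll2 L f)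
  simp only [ENNReal.toReal_ofNat, Real.rpow_ofNat] at h
  change ‖H2per.toEll2 L f‖ ^ 2 = _
  rw [h, ← tsum_mul_left]
  congr 1
  funext n
  change ‖h2Coeff f.toL2 n‖ ^ 2 = _
  rw [h2Coeff, norm_mul, Complex.norm_real, Real.norm_of_nonneg (by positivity), mul_pow, mul_pow,
    Real.sq_sqrt hL.le]
  ring

variable {L}

/-- The element `f` of `H²_per` is (the class of) the real-valued function `φ` on the line. -/
def H2per.IsClassOf (f : H2per L) (φ : ℝ → ℝ) : Prop :=
  ∀ᵐ x : ℝ, f.toL2 (x : AddCircle L) = (φ x : ℂ)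

end Sobolev

end

/-!
Everything rests on two smoothness principles and on one polynomial identity.

*Smoothness.* A family of functions on a compact space that is jointly smooth in the parameter and
the point is a smooth map into the space of continuous functions with the supremum norm
(`ContinuousMap.contDiffOn_of_uncurry`, by induction on the order of differentiability: the uniform
mean value inequality identifies the derivative of the family with the family of partial
derivatives). Composing with the integral shows that `F(η, k)` is jointly smooth
(`contDiffOn_ellipticF`), and the inverse function theorem for `(η, k) ↦ (F(η, k), k)` gives the
joint smoothness of the amplitude (`contDiffOn_jacobiAm`), hence of the wave in `(k, x)`.
On the circle, the same principle makes `√L (φ - (L/2π)² φ'')` a smooth curve in `C(ℝ/Lℤ)`. Its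
Fourier coefficients are `√L (1 + n²) φ̂(n)`, so a fixed continuous linear map
`C(ℝ/Lℤ) → L² ≃ ℓ² ≃ H²_per` carries this curve to `φ` (`H2per.isClassOf_ofContinuous`,
`exists_contDiffOn_isClassOf`).

*The equation.* With `R = √(k⁴ - k² + 1)`, the normalized profile `f = cn / √(1 - q sn²)` satisfies
`f'' = R f - (2 - k² + 2R) f⁵` (`hasDerivAt_normalizedProfileDeriv`): after clearing denominators
this is an identity between polynomials in `sn²`, and it holds because `q = -1 + k² - R`. The
constants `a` and `ω` are what the scaling `u = 4K x / L` requires.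

*The parameters.* Since `sin²` has mean `1/2` on `[0, π/2]`, Jensen's inequality gives
`K² (1 - k²/2) ≥ π²/4` (`pi_sq_le_ellipticK_sq`), and `R > 1 - k²/2`; the bounds for `a` and `ω`
follow. By convexity of `x ↦ 1/√x`, the function `K` has explicit supporting curves, which give its
derivative (`hasDerivAt_ellipticK`), and Chebyshev's inequality bounds it below by `k K / (2 - k²)`
(`ellipticK_le_mul_ellipticP`). This is enough for `dω/dk > 0`. As `ω → 4π²/L²` for `k → 0` and
`K → ∞` logarithmically for `k → 1`, the map `k ↦ ω` is a bijection, with smooth inverse.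
-/

/-! ### Smooth families of continuous functions and of integrals -/

section Curry

open Filter Topology

/-- The case `n = 0` of `ContinuousMap.contDiffOn_of_uncurry`. -/
theorem ContinuousMap.continuousOn_of_uncurry {E Y K S F : Type*} [TopologicalSpace E]
    [TopologicalSpace Y] [TopologicalSpace K] [TopologicalSpace S] [TopologicalSpace F]
    {U : Set E} {p : S → K} (hp : IsOpenQuotientMap p) {i : S → Y} (hi : Continuous i)
    {g : E → C(K, F)} {G : E × Y → F} (hG : ContinuousOn G (U ×ˢ univ))
    (h : ∀ x ∈ U, ∀ s, g x (p s) = G (x, i s)) : ContinuousOn g U := by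
  rw [continuousOn_iff_continuous_domRestrict]
  have hc : Continuous fun z : U × K => g z.1 z.2 := by
    rw [((IsOpenQuotientMap.id (X := U)).prodMap hp).isQuotientMap.continuous_iff]
    have : (fun z : U × S => G (z.1, i z.2)) =
        (fun z : U × K => g z.1 z.2) ∘ Prod.map id p := by
      funext z
      exact (h z.1 z.1.2 z.2).symm
    rw [← this]
    refine hG.comp_continuous (by fun_prop) fun z => ⟨z.1.2, mem_univ _⟩
  exact (ContinuousMap.curry ⟨_, hc⟩).continuous

universe u

variable {E : Type u} [NormedAddCommGroup E] [NormedSpace ℝ E]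
  {Y : Type*} [NormedAddCommGroup Y] [NormedSpace ℝ Y]
  {K : Type*} [TopologicalSpace K] [CompactSpace K] {S : Type*} [TopologicalSpace S]

/-- Evaluation of a continuous family of linear maps on a fixed vector, as a continuous linear map
`C(K, E →L F) → (E →L C(K, F))`. -/
noncomputable def ContinuousMap.flipCLM {F : Type u} [NormedAddCommGroup F] [NormedSpace ℝ F] :
    C(K, E →L[ℝ] F) →L[ℝ] E →L[ℝ] C(K, F) :=
  LinearMap.mkContinuous₂
    (LinearMap.mk₂ ℝ
      (fun (A : C(K, E →L[ℝ] F)) (v : E) => (⟨fun y => A y v, by fun_prop⟩ : C(K, F)))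
      (fun _ _ _ => by ext; simp) (fun _ _ _ => by ext; simp) (fun _ _ _ => by ext; simp)
      (fun _ _ _ => by ext; simp))
    1 fun A v => by
      rw [one_mul, ContinuousMap.norm_le _ (by positivity)]
      intro y
      exact ((A y).le_opNorm v).trans (by gcongr; exact A.norm_coe_le_norm y)

theorem ContinuousMap.flipCLM_apply {F : Type u} [NormedAddCommGroup F] [NormedSpace ℝ F]
    (A : C(K, E →L[ℝ] F)) (v : E) (y : K) : ContinuousMap.flipCLM A v y = A y v := rfl

/-- A family `g x` of continuous functions on a compact space is a smooth curve in the space of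
continuous functions, for the supremum norm, as soon as it is jointly smooth in the parameter
and the point. The points of the compact space `K` are parametrized by `p : S → K` and
`i : S → Y`, so that the statement covers compact subsets of `Y` as well as quotients of `Y`. -/
theorem ContinuousMap.contDiffOn_of_uncurry {U : Set E} (hU : IsOpen U) {p : S → K}
    (hp : IsOpenQuotientMap p) {i : S → Y} (hi : Continuous i) (n : ℕ) :
    ∀ {F : Type u} [NormedAddCommGroup F] [NormedSpace ℝ F] {g : E → C(K, F)} {G : E × Y → F},
      ContDiffOn ℝ n G (U ×ˢ univ) → (∀ x ∈ U, ∀ s, g x (p s) = G (x, i s)) →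
      ContDiffOn ℝ n g U := by
  classical
  induction n with
  | zero =>
    intro F _ _ g G hG h
    rw [Nat.cast_zero, contDiffOn_zero] at *
    exact ContinuousMap.continuousOn_of_uncurry hp hi hG h
  | succ n ih =>
    intro F _ _ g G hG h
    have hUo : IsOpen (U ×ˢ (univ : Set Y)) := hU.prod isOpen_univ
    push_cast at hG ⊢
    -- the partial derivative in the direction of `E`
    let G' : E × Y → (E →L[ℝ] F) := fun z => (fderiv ℝ G z).comp (ContinuousLinearMap.inl ℝ E Y)
    have hG' : ContDiffOn ℝ n G' (U ×ˢ univ) :=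
      (hG.fderiv_of_isOpen hUo le_rfl).clm_comp contDiffOn_const
    have hGd : ∀ x ∈ U, ∀ y, HasFDerivAt (fun x' => G (x', y)) (G' (x, y)) x := by
      intro x hx y
      have h1 : HasFDerivAt G (fderiv ℝ G (x, y)) (x, y) :=
        ((hG.differentiableOn (by simp)).differentiableAt
          (hUo.mem_nhds ⟨hx, mem_univ y⟩)).hasFDerivAt
      exact h1.comp x (hasFDerivAt_prodMk_left x y)
    have hgd : ∀ x ∈ U, ∀ s, HasFDerivAt (fun x' => g x' (p s)) (G' (x, i s)) x := by
      intro x hx s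
      refine (hGd x hx (i s)).congr_of_eventuallyEq ?_
      filter_upwards [hU.mem_nhds hx] with x' hx' using h x' hx' s
    have hcont : ∀ x ∈ U, Continuous fun y : K => fderiv ℝ (fun x' => g x' y) x := by
      intro x hx
      rw [hp.isQuotientMap.continuous_iff]
      have : (fun y : K => fderiv ℝ (fun x' => g x' y) x) ∘ p = fun s => G' (x, i s) := by
        funext s
        exact (hgd x hx s).fderiv
      rw [this]
      exact hG'.continuousOn.comp_continuous (by fun_prop) fun s => ⟨hx, mem_univ _⟩
    let g' : E → C(K, E →L[ℝ] F) := fun x =>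
      if hx : x ∈ U then ⟨fun y => fderiv ℝ (fun x' => g x' y) x, hcont x hx⟩ else 0
    have hg' : ∀ x ∈ U, ∀ s, g' x (p s) = G' (x, i s) := by
      intro x hx s
      simp only [g', dif_pos hx]
      exact (hgd x hx s).fderiv
    have hg'C : ContDiffOn ℝ n g' U := ih hG' hg'
    have hder : ∀ x ∈ U, HasFDerivAt g (ContinuousMap.flipCLM (g' x)) x := by
      intro x hx
      rw [hasFDerivAt_iff_isLittleO, Asymptotics.isLittleO_iff]
      intro c hc
      have hca : ContinuousAt g' x := hg'C.continuousOn.continuousAt (hU.mem_nhds hx)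
      have hev : ∀ᶠ x' in 𝓝 x, x' ∈ U ∧ dist (g' x') (g' x) < c :=
        Filter.Eventually.and (hU.mem_nhds hx) (Metric.continuousAt_iff'.1 hca c hc)
      obtain ⟨δ, hδ, hball⟩ := Metric.eventually_nhds_iff_ball.1 hev
      filter_upwards [Metric.ball_mem_nhds x hδ] with x' hx'
      rw [ContinuousMap.norm_le _ (by positivity)]
      intro y
      obtain ⟨s, rfl⟩ := hp.surjective y
      simp only [ContinuousMap.sub_apply, ContinuousMap.flipCLM_apply]
      refine (convex_ball x δ).norm_image_sub_le_of_norm_hasFDerivWithin_le'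
        (f := fun z => g z (p s)) (f' := fun z => g' z (p s)) (φ := g' x (p s)) (C := c) ?_ ?_
        (Metric.mem_ball_self hδ) hx'
      · intro z hz
        rw [hg' z (hball z hz).1]
        exact (hgd z (hball z hz).1 s).hasFDerivWithinAt
      · intro z hz
        have h1 := ContinuousMap.dist_apply_le_dist (f := g' z) (g := g' x) (p s)
        rw [dist_eq_norm_sub] at h1
        exact h1.trans (hball z hz).2.le
    rw [contDiffOn_succ_iff_fderiv_of_isOpen hU]
    refine ⟨fun x hx => (hder x hx).differentiableAt.differentiableWithinAt, by simp, ?_⟩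
    refine (ContinuousMap.flipCLM.contDiff.comp_contDiffOn hg'C).congr fun x hx => ?_
    exact (hder x hx).fderiv

/-- Smooth dependence of an integral over `[0, 1]` on parameters. -/
theorem contDiffOn_integral_zero_one {F : Type u} [NormedAddCommGroup F] [NormedSpace ℝ F]
    {U : Set E} (hU : IsOpen U) {f : E × ℝ → F}
    (hf : ContDiffOn ℝ ∞ f (U ×ˢ univ)) :
    ContDiffOn ℝ ∞ (fun x => ∫ t in (0 : ℝ)..1, f (x, t)) U := by
  classical
  let I : C(Icc (0 : ℝ) 1, F) →L[ℝ] F :=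
    LinearMap.mkContinuous
      { toFun := fun g => ∫ t in (0 : ℝ)..1, g (projIcc 0 1 zero_le_one t)
        map_add' := fun g₁ g₂ => by
          simp only [ContinuousMap.add_apply]
          exact intervalIntegral.integral_add (by
            refine Continuous.intervalIntegrable ?_ _ _; fun_prop) (by
            refine Continuous.intervalIntegrable ?_ _ _; fun_prop)
        map_smul' := fun c g => by simp }
      1 fun g => by
        have := intervalIntegral.norm_integral_le_of_norm_le_const (a := (0 : ℝ)) (b := 1)
          (f := fun t => g (projIcc 0 1 zero_le_one t)) (C := ‖g‖)
          fun t _ => g.norm_coe_le_norm _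
        simpa using this
  have hcont : ∀ x ∈ U, Continuous fun t : Icc (0 : ℝ) 1 => f (x, t) := fun x hx =>
    hf.continuousOn.comp_continuous (by fun_prop) fun t => ⟨hx, mem_univ _⟩
  let g : E → C(Icc (0 : ℝ) 1, F) := fun x => if hx : x ∈ U then ⟨_, hcont x hx⟩ else 0
  have hg : ContDiffOn ℝ ∞ g U := by
    rw [contDiffOn_infty]
    intro n
    refine ContinuousMap.contDiffOn_of_uncurry hU (p := id) IsOpenQuotientMap.id
      (i := Subtype.val) continuous_subtype_val n (hf.of_le (by exact_mod_cast le_top)) ?_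
    intro x hx s
    simp only [g, dif_pos hx, id]
    rfl
  refine (I.contDiff.comp_contDiffOn hg).congr fun x hx => ?_
  refine intervalIntegral.integral_congr fun t ht => ?_
  rw [uIcc_of_le zero_le_one] at ht
  simp only [g, dif_pos hx, projIcc_of_mem zero_le_one ht]
  rfl

end Curry

/-! ### The elliptic integral and the Jacobi amplitude -/

section Elliptic

open Filter Topology

theorem one_sub_sq_mul_sin_sq_pos {k : ℝ} (hk : k ∈ Ioo (-1 : ℝ) 1) (t : ℝ) :
    0 < 1 - k ^ 2 * Real.sin t ^ 2 := by
  have h1 : k ^ 2 < 1 := by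
    rw [sq_lt_one_iff_abs_lt_one, abs_lt]
    exact hk
  nlinarith [Real.sin_sq_le_one t, sq_nonneg k]

theorem Ioo_zero_one_subset : Ioo (0 : ℝ) 1 ⊆ Ioo (-1) 1 :=
  Ioo_subset_Ioo_left (by norm_num)

theorem continuous_ellipticF_integrand {k : ℝ} (hk : k ∈ Ioo (-1 : ℝ) 1) :
    Continuous fun t : ℝ => 1 / Real.sqrt (1 - k ^ 2 * Real.sin t ^ 2) :=
  Continuous.div (by fun_prop) (by fun_prop)
    fun t => (Real.sqrt_pos.2 (one_sub_sq_mul_sin_sq_pos hk t)).ne'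

theorem hasDerivAt_ellipticF {k : ℝ} (hk : k ∈ Ioo (-1 : ℝ) 1) (η : ℝ) :
    HasDerivAt (fun η => ellipticF η k) (1 / Real.sqrt (1 - k ^ 2 * Real.sin η ^ 2)) η :=
  intervalIntegral.integral_hasDerivAt_right
    ((continuous_ellipticF_integrand hk).intervalIntegrable _ _)
    (continuous_ellipticF_integrand hk).stronglyMeasurable.stronglyMeasurableAtFilter
    (continuous_ellipticF_integrand hk).continuousAt

/-- The elliptic integral is jointly smooth: the substitution `t = η s` makes the domain of
integration independent of `η`. -/
theorem contDiffOn_ellipticF :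
    ContDiffOn ℝ ∞ (fun p : ℝ × ℝ => ellipticF p.1 p.2) (univ ×ˢ Ioo (-1) 1) := by
  have h : ContDiffOn ℝ ∞
      (fun z : (ℝ × ℝ) × ℝ => z.1.1 * (1 / Real.sqrt (1 - z.1.2 ^ 2 * Real.sin (z.1.1 * z.2) ^ 2)))
      ((univ ×ˢ Ioo (-1 : ℝ) 1) ×ˢ univ) := by
    have hpos : ∀ z ∈ ((univ : Set ℝ) ×ˢ Ioo (-1 : ℝ) 1) ×ˢ (univ : Set ℝ),
        0 < 1 - z.1.2 ^ 2 * Real.sin (z.1.1 * z.2) ^ 2 :=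
      fun z hz => one_sub_sq_mul_sin_sq_pos hz.1.2 _
    refine ContDiffOn.mul (by fun_prop) (contDiffOn_const.div (ContDiffOn.sqrt ?_ ?_) ?_)
    · fun_prop
    · exact fun z hz => (hpos z hz).ne'
    · exact fun z hz => (Real.sqrt_pos.2 (hpos z hz)).ne'
  refine (contDiffOn_integral_zero_one (isOpen_univ.prod isOpen_Ioo) h).congr fun p hp => ?_
  simp only [ellipticF]
  rw [intervalIntegral.integral_const_mul]
  have := intervalIntegral.mul_integral_comp_mul_left (a := 0) (b := 1)
    (f := fun t => 1 / Real.sqrt (1 - p.2 ^ 2 * Real.sin t ^ 2)) p.1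
  rw [mul_zero, mul_one] at this
  exact this.symm

theorem contDiffOn_ellipticK : ContDiffOn ℝ ∞ ellipticK (Ioo (-1) 1) :=
  contDiffOn_ellipticF.comp (f := fun k : ℝ => (Real.pi / 2, k)) (by fun_prop)
    fun k hk => ⟨mem_univ _, hk⟩

theorem ellipticF_strictMono {k : ℝ} (hk : k ∈ Ioo (-1 : ℝ) 1) :
    StrictMono fun η => ellipticF η k := by
  refine strictMono_of_hasDerivAt_pos (hasDerivAt_ellipticF hk) fun η => ?_
  exact one_div_pos.2 (Real.sqrt_pos.2 (one_sub_sq_mul_sin_sq_pos hk η))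

theorem ellipticF_zero (k : ℝ) : ellipticF 0 k = 0 := intervalIntegral.integral_same

/-- Since the integrand is at least `1`, the difference `F(η, k) - η` is increasing. -/
theorem ellipticF_sub_id_monotone {k : ℝ} (hk : k ∈ Ioo (-1 : ℝ) 1) :
    Monotone fun η => ellipticF η k - η := by
  refine monotone_of_hasDerivAt_nonneg
    (fun η => (hasDerivAt_ellipticF hk η).sub (hasDerivAt_id η)) fun η => ?_
  rw [Pi.zero_apply, sub_nonneg]
  have hp := one_sub_sq_mul_sin_sq_pos hk η
  rw [le_div_iff₀ (Real.sqrt_pos.2 hp), one_mul]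
  rw [Real.sqrt_le_one]
  nlinarith [mul_nonneg (sq_nonneg k) (sq_nonneg (Real.sin η))]

theorem ellipticF_surjective {k : ℝ} (hk : k ∈ Ioo (-1 : ℝ) 1) :
    Function.Surjective fun η => ellipticF η k := by
  have hm := ellipticF_sub_id_monotone hk
  refine Continuous.surjective
    (continuous_iff_continuousAt.2 fun η => (hasDerivAt_ellipticF hk η).continuousAt) ?_ ?_
  · refine tendsto_atTop_mono' _ ?_ tendsto_id
    filter_upwards [eventually_ge_atTop 0] with η hη
    have := hm hη
    simp only [ellipticF_zero] at this
    simp only [id]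
    linarith
  · refine tendsto_atBot_mono' _ ?_ tendsto_id
    filter_upwards [eventually_le_atBot 0] with η hη
    have := hm hη
    simp only [ellipticF_zero] at this
    simp only [id]
    linarith

theorem ellipticF_jacobiAm {k : ℝ} (hk : k ∈ Ioo (-1 : ℝ) 1) (u : ℝ) :
    ellipticF (jacobiAm u k) k = u :=
  Function.rightInverse_invFun (ellipticF_surjective hk) u

theorem jacobiAm_ellipticF {k : ℝ} (hk : k ∈ Ioo (-1 : ℝ) 1) (η : ℝ) :
    jacobiAm (ellipticF η k) k = η :=
  Function.leftInverse_invFun (ellipticF_strictMono hk).injective η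

/-- Joint smoothness of the amplitude, from the inverse function theorem for
`(η, k) ↦ (F(η, k), k)`. -/
theorem contDiffOn_jacobiAm :
    ContDiffOn ℝ ∞ (fun p : ℝ × ℝ => jacobiAm p.1 p.2) (univ ×ˢ Ioo (-1) 1) := by
  have hUo : IsOpen ((univ : Set ℝ) ×ˢ Ioo (-1 : ℝ) 1) := isOpen_univ.prod isOpen_Ioo
  rintro ⟨u, k⟩ ⟨-, hk⟩
  refine ContDiffAt.contDiffWithinAt ?_
  have hF : ContDiffAt ℝ ∞ (fun p : ℝ × ℝ => ellipticF p.1 p.2) (jacobiAm u k, k) :=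
    contDiffOn_ellipticF.contDiffAt (hUo.mem_nhds ⟨mem_univ _, hk⟩)
  let f : ℝ × ℝ → ℝ × ℝ := fun p => (ellipticF p.1 p.2, p.2)
  have hf : ContDiffAt ℝ ∞ f (jacobiAm u k, k) := hF.prodMk contDiffAt_snd
  let A := fderiv ℝ (fun p : ℝ × ℝ => ellipticF p.1 p.2) (jacobiAm u k, k)
  have hA : HasFDerivAt (fun p : ℝ × ℝ => ellipticF p.1 p.2) A (jacobiAm u k, k) :=
    (hF.differentiableAt (by simp)).hasFDerivAt
  let c := A (1, 0)
  have hc : c = 1 / Real.sqrt (1 - k ^ 2 * Real.sin (jacobiAm u k) ^ 2) := by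
    refine HasDerivAt.unique ?_ (hasDerivAt_ellipticF hk (jacobiAm u k))
    have := hA.comp_hasDerivAt (jacobiAm u k)
      ((hasDerivAt_id (jacobiAm u k)).prodMk (hasDerivAt_const (jacobiAm u k) k))
    exact this
  have hc0 : c ≠ 0 := by
    rw [hc]
    exact (one_div_pos.2 (Real.sqrt_pos.2 (one_sub_sq_mul_sin_sq_pos hk _))).ne'
  have hAv : ∀ v : ℝ × ℝ, A v = c * v.1 + A (0, 1) * v.2 := by
    intro v
    have : v = v.1 • ((1, 0) : ℝ × ℝ) + v.2 • ((0, 1) : ℝ × ℝ) := by ext <;> simp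
    conv_lhs => rw [this]
    rw [map_add, map_smul, map_smul, smul_eq_mul, smul_eq_mul]
    ring
  let e : (ℝ × ℝ) ≃L[ℝ] (ℝ × ℝ) :=
    ContinuousLinearEquiv.equivOfInverse (A.prod (ContinuousLinearMap.snd ℝ ℝ ℝ))
      ((c⁻¹ • (ContinuousLinearMap.fst ℝ ℝ ℝ - A (0, 1) • ContinuousLinearMap.snd ℝ ℝ ℝ)).prod
        (ContinuousLinearMap.snd ℝ ℝ ℝ))
      (fun v => by
        ext
        · simp [hAv v]; field_simp
        · simp)
      (fun v => by
        ext
        · simp [hAv (c⁻¹ * (v.1 - A (0, 1) * v.2), v.2)]; field_simp; ring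
        · simp)
  have hfe : HasFDerivAt f (e : ℝ × ℝ →L[ℝ] ℝ × ℝ) (jacobiAm u k, k) :=
    hA.prodMk hasFDerivAt_snd
  have hfa : f (jacobiAm u k, k) = (u, k) := by simp [f, ellipticF_jacobiAm hk]
  have h0 : (∞ : WithTop ℕ∞) ≠ 0 := by simp
  let g := hf.localInverse hfe h0
  have hinv : ContDiffAt ℝ ∞ g (f (jacobiAm u k, k)) := hf.to_localInverse hfe h0
  have hright : ∀ᶠ y in 𝓝 (f (jacobiAm u k, k)), f (g y) = y :=
    (hf.hasStrictFDerivAt' hfe h0).eventually_right_inverse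
  rw [hfa] at hinv hright
  refine (contDiffAt_fst.comp _ hinv).congr_of_eventuallyEq ?_
  have hU : (univ : Set ℝ) ×ˢ Ioo (-1 : ℝ) 1 ∈ 𝓝 (u, k) := hUo.mem_nhds ⟨mem_univ _, hk⟩
  filter_upwards [hright, hU] with y hy hyU
  have h1 : ellipticF (g y).1 (g y).2 = y.1 := (Prod.ext_iff.1 hy).1
  have h2 : (g y).2 = y.2 := (Prod.ext_iff.1 hy).2
  rw [h2] at h1
  rw [Function.comp_apply, ← h1, jacobiAm_ellipticF hyU.2]

theorem hasDerivAt_jacobiAm {k : ℝ} (hk : k ∈ Ioo (-1 : ℝ) 1) (u : ℝ) :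
    HasDerivAt (fun u => jacobiAm u k) (Real.sqrt (1 - k ^ 2 * Real.sin (jacobiAm u k) ^ 2)) u := by
  have hs := Real.sqrt_pos.2 (one_sub_sq_mul_sin_sq_pos hk (jacobiAm u k))
  have hcont : ContinuousAt (fun u => jacobiAm u k) u := by
    refine (ContinuousOn.continuousAt (s := univ) ?_ univ_mem)
    exact contDiffOn_jacobiAm.continuousOn.comp (f := fun u : ℝ => (u, k)) (by fun_prop)
      fun _ _ => ⟨mem_univ _, hk⟩
  have := HasDerivAt.of_local_left_inverse hcont (hasDerivAt_ellipticF hk (jacobiAm u k))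
    (one_div_pos.2 hs).ne' (Eventually.of_forall fun v => ellipticF_jacobiAm hk v)
  simpa using this

theorem ellipticF_add_pi {k : ℝ} (hk : k ∈ Ioo (-1 : ℝ) 1) (η : ℝ) :
    ellipticF (η + Real.pi) k = ellipticF η k + 2 * ellipticK k := by
  have hi := fun a b => (continuous_ellipticF_integrand hk).intervalIntegrable (μ := volume) a b
  have hper : Function.Periodic (fun t : ℝ => 1 / Real.sqrt (1 - k ^ 2 * Real.sin t ^ 2))
      Real.pi := fun t => by simp [Real.sin_add_pi]
  have h1 := hper.intervalIntegral_add_eq η 0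
  have h2 := intervalIntegral.integral_comp_sub_left (a := 0) (b := Real.pi / 2)
    (fun t : ℝ => 1 / Real.sqrt (1 - k ^ 2 * Real.sin t ^ 2)) Real.pi
  rw [sub_zero, show Real.pi - Real.pi / 2 = Real.pi / 2 by ring] at h2
  simp only [Real.sin_pi_sub] at h2
  simp only [ellipticK, ellipticF]
  rw [← intervalIntegral.integral_add_adjacent_intervals (hi 0 η) (hi η (η + Real.pi)), h1,
    zero_add, ← intervalIntegral.integral_add_adjacent_intervals (hi 0 (Real.pi / 2))
    (hi (Real.pi / 2) Real.pi), ← h2]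
  ring

theorem jacobiAm_add_four_mul_ellipticK {k : ℝ} (hk : k ∈ Ioo (-1 : ℝ) 1) (u : ℝ) :
    jacobiAm (u + 4 * ellipticK k) k = jacobiAm u k + 2 * Real.pi := by
  have : u + 4 * ellipticK k = ellipticF (jacobiAm u k + 2 * Real.pi) k := by
    rw [two_mul, ← add_assoc, ellipticF_add_pi hk, ellipticF_add_pi hk, ellipticF_jacobiAm hk]
    ring
  rw [this, jacobiAm_ellipticF hk]

end Elliptic

/-! ### The complete elliptic integral and the parameters of the wave -/

section Parameters

open Filter Topology

theorem ellipticK_pos {k : ℝ} (hk : k ∈ Ioo (-1 : ℝ) 1) : 0 < ellipticK k := by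
  have := ellipticF_strictMono hk (by positivity : (0 : ℝ) < Real.pi / 2)
  simp only [ellipticF_zero] at this
  exact this

theorem ellipticK_zero : ellipticK 0 = Real.pi / 2 := by
  simp [ellipticK, ellipticF]

/-- The function `x ↦ 1 / √x` lies above its tangent at `a`. -/
theorem tangent_le_one_div_sqrt {a x : ℝ} (ha : 0 < a) (hx : 0 < x) :
    1 / Real.sqrt a - (x - a) / (2 * Real.sqrt a ^ 3) ≤ 1 / Real.sqrt x := by
  have hA := Real.sqrt_pos.2 ha
  have hX := Real.sqrt_pos.2 hx
  conv_lhs => rw [← Real.sq_sqrt ha.le, ← Real.sq_sqrt hx.le]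
  rw [Real.sqrt_sq hA.le, ← sub_nonneg]
  set A := Real.sqrt a
  set X := Real.sqrt x
  have : 1 / X - (1 / A - (X ^ 2 - A ^ 2) / (2 * A ^ 3))
      = (X - A) ^ 2 * (X + 2 * A) / (2 * A ^ 3 * X) := by
    field_simp
    ring
  rw [this]
  positivity

theorem integral_two_mul_sin_sq_sub_one :
    ∫ t in (0 : ℝ)..Real.pi / 2, (2 * Real.sin t ^ 2 - 1) = 0 := by
  rw [intervalIntegral.integral_sub (Continuous.intervalIntegrable (by fun_prop) _ _)
    (Continuous.intervalIntegrable (by fun_prop) _ _), intervalIntegral.integral_const_mul,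
    integral_sin_sq]
  simp
  ring

/-- Jensen's inequality for `K`: the average of `1 - k² sin² t` is `1 - k² / 2`. -/
theorem pi_sq_le_ellipticK_sq {k : ℝ} (hk : k ∈ Ioo (-1 : ℝ) 1) :
    Real.pi ^ 2 ≤ 2 * (2 - k ^ 2) * ellipticK k ^ 2 := by
  have hk2 : k ^ 2 < 1 := by
    rw [sq_lt_one_iff_abs_lt_one, abs_lt]
    exact hk
  have ha : 0 < 1 - k ^ 2 / 2 := by linarith
  have hA := Real.sqrt_pos.2 ha
  have h : ∫ t in (0 : ℝ)..Real.pi / 2, (1 / Real.sqrt (1 - k ^ 2 / 2)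
      + k ^ 2 / (4 * Real.sqrt (1 - k ^ 2 / 2) ^ 3) * (2 * Real.sin t ^ 2 - 1)) ≤ ellipticK k := by
    refine intervalIntegral.integral_mono_on (by positivity)
      (Continuous.intervalIntegrable (by fun_prop) _ _)
      ((continuous_ellipticF_integrand hk).intervalIntegrable _ _) fun t _ => ?_
    refine le_trans (le_of_eq ?_)
      (tangent_le_one_div_sqrt ha (one_sub_sq_mul_sin_sq_pos hk t))
    field_simp
    ring
  rw [intervalIntegral.integral_add (Continuous.intervalIntegrable (by fun_prop) _ _)
    (Continuous.intervalIntegrable (by fun_prop) _ _), intervalIntegral.integral_const_mul,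
    integral_two_mul_sin_sq_sub_one, intervalIntegral.integral_const, mul_zero, add_zero,
    sub_zero, smul_eq_mul, mul_one_div, div_le_iff₀ hA] at h
  have h2 := mul_self_le_mul_self (by positivity) h
  have h3 : ellipticK k * Real.sqrt (1 - k ^ 2 / 2) * (ellipticK k * Real.sqrt (1 - k ^ 2 / 2))
      = ellipticK k ^ 2 * (1 - k ^ 2 / 2) := by
    rw [mul_mul_mul_comm, Real.mul_self_sqrt ha.le]
    ring
  rw [h3] at h2
  nlinarith

/-- The integral `P(k) = ∫_0^{π/2} sin² t (1 - k² sin² t)^{-3/2} dt`, for which `K' = k P`. -/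
noncomputable def ellipticP (k : ℝ) : ℝ :=
  ∫ t in (0 : ℝ)..Real.pi / 2, Real.sin t ^ 2 / Real.sqrt (1 - k ^ 2 * Real.sin t ^ 2) ^ 3

theorem continuous_ellipticP_integrand {k : ℝ} (hk : k ∈ Ioo (-1 : ℝ) 1) :
    Continuous fun t : ℝ => Real.sin t ^ 2 / Real.sqrt (1 - k ^ 2 * Real.sin t ^ 2) ^ 3 :=
  Continuous.div (by fun_prop) (by fun_prop)
    fun t => (pow_pos (Real.sqrt_pos.2 (one_sub_sq_mul_sin_sq_pos hk t)) 3).ne'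

/-- By convexity of `x ↦ 1 / √x`, the function `K` of `k²` lies above a line of slope `P / 2`. -/
theorem ellipticK_add_le {k l : ℝ} (hk : k ∈ Ioo (-1 : ℝ) 1) (hl : l ∈ Ioo (-1 : ℝ) 1) :
    ellipticK k + (l ^ 2 - k ^ 2) / 2 * ellipticP k ≤ ellipticK l := by
  have hi1 := (continuous_ellipticF_integrand hk).intervalIntegrable (μ := volume)
    0 (Real.pi / 2)
  have hi2 := (continuous_ellipticP_integrand hk).intervalIntegrable (μ := volume)
    0 (Real.pi / 2)
  have hi3 := (continuous_ellipticF_integrand hl).intervalIntegrable (μ := volume)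
    0 (Real.pi / 2)
  simp only [ellipticK, ellipticF, ellipticP]
  rw [← intervalIntegral.integral_const_mul,
    ← intervalIntegral.integral_add hi1 (hi2.const_mul _)]
  refine intervalIntegral.integral_mono_on (by positivity) (hi1.add (hi2.const_mul _)) hi3
    fun t _ => ?_
  refine le_trans (le_of_eq ?_) (tangent_le_one_div_sqrt (one_sub_sq_mul_sin_sq_pos hk t)
    (one_sub_sq_mul_sin_sq_pos hl t))
  have := Real.sqrt_pos.2 (one_sub_sq_mul_sin_sq_pos hk t)
  field_simp
  ring

theorem hasDerivAt_ellipticK {k : ℝ} (hk : k ∈ Ioo (-1 : ℝ) 1) :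
    HasDerivAt ellipticK (k * ellipticP k) k := by
  have hd : DifferentiableAt ℝ ellipticK k :=
    (contDiffOn_ellipticK.differentiableOn (by simp)).differentiableAt (isOpen_Ioo.mem_nhds hk)
  -- the difference of `K` and its supporting line has a minimum at `k`
  have hmin : IsLocalMin (fun l => ellipticK l - (l ^ 2 - k ^ 2) / 2 * ellipticP k) k := by
    filter_upwards [isOpen_Ioo.mem_nhds hk] with l hl
    have := ellipticK_add_le hk hl
    simp only [sub_self, zero_div, zero_mul, sub_zero]
    linarith
  have h1 : HasDerivAt (fun l => ellipticK l - (l ^ 2 - k ^ 2) / 2 * ellipticP k)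
      (deriv ellipticK k - k * ellipticP k) k := by
    have h2 : HasDerivAt (fun l : ℝ => (l ^ 2 - k ^ 2) / 2 * ellipticP k) (k * ellipticP k) k := by
      have := ((((hasDerivAt_id k).pow 2).sub_const (k ^ 2)).div_const 2).mul_const (ellipticP k)
      refine this.congr_deriv ?_
      simp
    exact hd.hasDerivAt.sub h2
  have h3 := hmin.hasDerivAt_eq_zero h1
  rw [← sub_eq_zero.1 h3]
  exact hd.hasDerivAt

/-- Chebyshev's inequality: `2 sin² t - 1` has mean zero and the weight `(1 - k² sin² t)^{-3/2}`
increases with `sin² t`. -/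
theorem ellipticK_le_mul_ellipticP {k : ℝ} (hk : k ∈ Ioo (-1 : ℝ) 1) :
    ellipticK k ≤ (2 - k ^ 2) * ellipticP k := by
  have hi1 := (continuous_ellipticF_integrand hk).intervalIntegrable (μ := volume)
    0 (Real.pi / 2)
  have hi2 := (continuous_ellipticP_integrand hk).intervalIntegrable (μ := volume)
    0 (Real.pi / 2)
  have hk2 : k ^ 2 < 1 := by
    rw [sq_lt_one_iff_abs_lt_one, abs_lt]
    exact hk
  have ha : 0 < 1 - k ^ 2 / 2 := by linarith
  have hA := Real.sqrt_pos.2 ha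
  rw [← sub_nonneg]
  simp only [ellipticK, ellipticF, ellipticP]
  rw [← intervalIntegral.integral_const_mul,
    ← intervalIntegral.integral_sub (hi2.const_mul _) hi1]
  have h0 : ∫ t in (0 : ℝ)..Real.pi / 2,
      1 / Real.sqrt (1 - k ^ 2 / 2) ^ 3 * (2 * Real.sin t ^ 2 - 1) = 0 := by
    rw [intervalIntegral.integral_const_mul, integral_two_mul_sin_sq_sub_one, mul_zero]
  refine h0.ge.trans ?_
  refine intervalIntegral.integral_mono_on (by positivity)
    (Continuous.intervalIntegrable (by fun_prop) _ _) ((hi2.const_mul _).sub hi1) fun t _ => ?_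
  have hw := one_sub_sq_mul_sin_sq_pos hk t
  have hW := Real.sqrt_pos.2 hw
  have hWsq := Real.sq_sqrt hw.le
  have heq : (2 - k ^ 2) * (Real.sin t ^ 2 / Real.sqrt (1 - k ^ 2 * Real.sin t ^ 2) ^ 3)
      - 1 / Real.sqrt (1 - k ^ 2 * Real.sin t ^ 2)
      = 1 / Real.sqrt (1 - k ^ 2 * Real.sin t ^ 2) ^ 3 * (2 * Real.sin t ^ 2 - 1) := by
    field_simp
    rw [hWsq]
    ring
  rw [heq]
  rcases le_total 0 (2 * Real.sin t ^ 2 - 1) with h | h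
  · refine mul_le_mul_of_nonneg_right ?_ h
    refine one_div_le_one_div_of_le (pow_pos hW 3) ?_
    refine pow_le_pow_left₀ hW.le (Real.sqrt_le_sqrt ?_) 3
    nlinarith [sq_nonneg k]
  · refine mul_le_mul_of_nonpos_right ?_ h
    refine one_div_le_one_div_of_le (pow_pos hA 3) ?_
    refine pow_le_pow_left₀ hA.le (Real.sqrt_le_sqrt ?_) 3
    nlinarith [sq_nonneg k]

/-- The logarithmic growth of `K` at `k = 1`. -/
theorem neg_log_sqrt_le_ellipticK {k : ℝ} (hk : k ∈ Ioo (-1 : ℝ) 1) :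
    -Real.log (Real.sqrt (1 - k ^ 2)) ≤ ellipticK k := by
  have hk2 : k ^ 2 < 1 := by
    rw [sq_lt_one_iff_abs_lt_one, abs_lt]
    exact hk
  have he := Real.sqrt_pos.2 (sub_pos.2 hk2)
  set e := Real.sqrt (1 - k ^ 2) with he_def
  have hesq : e ^ 2 = 1 - k ^ 2 := Real.sq_sqrt (by linarith)
  have hpi := Real.pi_gt_three
  have h1 : ∫ t in (0 : ℝ)..Real.pi / 2, 1 / (e + Real.pi / 2 - t)
      = Real.log ((e + Real.pi / 2) / e) := by
    rw [intervalIntegral.integral_comp_sub_left (fun x => 1 / x), integral_one_div]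
    · congr 2 <;> ring
    · rw [uIcc_of_le (by linarith)]
      intro h
      have := h.1
      linarith
  have h2 : ∫ t in (0 : ℝ)..Real.pi / 2, 1 / (e + Real.pi / 2 - t) ≤ ellipticK k := by
    refine intervalIntegral.integral_mono_on (by positivity) ?_
      ((continuous_ellipticF_integrand hk).intervalIntegrable _ _) fun t ht => ?_
    · refine ContinuousOn.intervalIntegrable ?_
      rw [uIcc_of_le (by positivity)]
      refine ContinuousOn.div (by fun_prop) (by fun_prop) fun t ht => ?_
      have := ht.2
      linarith
    · have hp : 0 < e + Real.pi / 2 - t := by linarith [ht.2]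
      refine one_div_le_one_div_of_le (Real.sqrt_pos.2 (one_sub_sq_mul_sin_sq_pos hk t)) ?_
      rw [Real.sqrt_le_left hp.le]
      have hcos : Real.cos t ≤ Real.pi / 2 - t := by
        rw [← Real.sin_pi_div_two_sub]
        exact Real.sin_le (by linarith [ht.2])
      have hcos0 : 0 ≤ Real.cos t :=
        Real.cos_nonneg_of_mem_Icc ⟨by linarith [ht.1], ht.2⟩
      nlinarith [Real.sin_sq_add_cos_sq t, mul_self_le_mul_self hcos0 hcos,
        mul_nonneg (sub_nonneg.2 hk2.le) (sq_nonneg (Real.cos t)),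
        mul_nonneg he.le (sub_nonneg.2 ht.2)]
  refine le_trans ?_ (h1 ▸ h2)
  rw [← Real.log_inv]
  refine Real.log_le_log (by positivity) ?_
  rw [inv_eq_one_div]
  gcongr
  linarith

/-! #### The parameters as functions of the modulus -/

theorem radicand_pos (k : ℝ) : 0 < k ^ 4 - k ^ 2 + 1 := by
  nlinarith [sq_nonneg (k ^ 2 - 1 / 2)]

theorem contDiff_sqrt_radicand : ContDiff ℝ ∞ fun k : ℝ => Real.sqrt (k ^ 4 - k ^ 2 + 1) :=
  ContDiff.sqrt (by fun_prop) fun k => (radicand_pos k).ne'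

theorem contDiff_cnoidalQ : ContDiff ℝ ∞ cnoidalQ := by
  have := contDiff_sqrt_radicand
  unfold cnoidalQ
  fun_prop

theorem cnoidalQ_mem {k : ℝ} (hk : k ∈ Ioo (0 : ℝ) 1) : cnoidalQ k ∈ Ioo (-2 : ℝ) (-1) := by
  have h0 := hk.1
  have h1 : k ^ 2 < 1 := by nlinarith [hk.1, hk.2]
  have h2 : 0 < k ^ 2 := by positivity
  constructor
  · have : Real.sqrt (k ^ 4 - k ^ 2 + 1) < 1 + k ^ 2 := by
      rw [Real.sqrt_lt' (by positivity)]
      nlinarith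
    unfold cnoidalQ
    linarith
  · have : k ^ 2 < Real.sqrt (k ^ 4 - k ^ 2 + 1) := by
      refine Real.lt_sqrt_of_sq_lt ?_
      nlinarith
    unfold cnoidalQ
    linarith

theorem one_sub_half_sq_lt_sqrt_radicand {k : ℝ} (hk : k ∈ Ioo (0 : ℝ) 1) :
    1 - k ^ 2 / 2 < Real.sqrt (k ^ 4 - k ^ 2 + 1) := by
  have h0 := hk.1
  refine Real.lt_sqrt_of_sq_lt ?_
  have : 0 < k ^ 4 := by positivity
  nlinarith

theorem pi_sq_lt_sqrt_radicand_mul {k : ℝ} (hk : k ∈ Ioo (0 : ℝ) 1) :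
    Real.pi ^ 2 < 4 * ellipticK k ^ 2 * Real.sqrt (k ^ 4 - k ^ 2 + 1) := by
  have h1 := pi_sq_le_ellipticK_sq (Ioo_zero_one_subset hk)
  have h2 := pow_pos (ellipticK_pos (Ioo_zero_one_subset hk)) 2
  nlinarith [one_sub_half_sq_lt_sqrt_radicand hk]

theorem cnoidalOmega_mem {k L : ℝ} (hL : 0 < L) (hk : k ∈ Ioo (0 : ℝ) 1) :
    cnoidalOmega k L ∈ Ioi (4 * Real.pi ^ 2 / L ^ 2) := by
  have := pi_sq_lt_sqrt_radicand_mul hk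
  rw [mem_Ioi, cnoidalOmega]
  gcongr 1
  linarith

/-- The coefficient `2 - k² + 2 √(k⁴ - k² + 1)`, which equals `a⁴ L² / (16 K²)`. -/
theorem two_sub_sq_add_pos {k : ℝ} (hk : k ∈ Ioo (-1 : ℝ) 1) :
    0 < 2 - k ^ 2 + 2 * Real.sqrt (k ^ 4 - k ^ 2 + 1) := by
  have hk2 : k ^ 2 < 1 := by
    rw [sq_lt_one_iff_abs_lt_one, abs_lt]
    exact hk
  linarith [Real.sqrt_nonneg (k ^ 4 - k ^ 2 + 1)]

theorem cnoidalA_radicand_pos {k L : ℝ} (hL : 0 < L) (hk : k ∈ Ioo (-1 : ℝ) 1) :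
    0 < (2 - k ^ 2 + 2 * Real.sqrt (k ^ 4 - k ^ 2 + 1)) * L ^ 2 * ellipticK k ^ 2 :=
  mul_pos (mul_pos (two_sub_sq_add_pos hk) (pow_pos hL 2)) (pow_pos (ellipticK_pos hk) 2)

theorem cnoidalA_pow_four {k L : ℝ} (hL : 0 < L) (hk : k ∈ Ioo (-1 : ℝ) 1) :
    cnoidalA k L ^ 4 =
      (2 - k ^ 2 + 2 * Real.sqrt (k ^ 4 - k ^ 2 + 1)) * (4 * ellipticK k / L) ^ 2 := by
  have h2 : ∀ x : ℝ, 0 < x → (x ^ (1 / 4 : ℝ)) ^ 4 = x := by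
    intro x hx
    rw [← Real.rpow_natCast, ← Real.rpow_mul hx.le]
    norm_num
  rw [cnoidalA, mul_pow, h2 _ (cnoidalA_radicand_pos hL hk)]
  field_simp
  ring

theorem cnoidalA_pos {k L : ℝ} (hL : 0 < L) (hk : k ∈ Ioo (-1 : ℝ) 1) : 0 < cnoidalA k L :=
  mul_pos (by positivity) (Real.rpow_pos_of_pos (cnoidalA_radicand_pos hL hk) _)

theorem cnoidalA_mem {k L : ℝ} (hL : 0 < L) (hk : k ∈ Ioo (0 : ℝ) 1) :
    cnoidalA k L ∈ Ioi (2 * Real.sqrt (Real.pi / L)) := by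
  have hk' := Ioo_zero_one_subset hk
  rw [mem_Ioi]
  refine lt_of_pow_lt_pow_left₀ 4 (cnoidalA_pos hL hk').le ?_
  rw [cnoidalA_pow_four hL hk']
  have h1 : (2 * Real.sqrt (Real.pi / L)) ^ 4 = 16 * Real.pi ^ 2 / L ^ 2 := by
    rw [mul_pow, show 4 = 2 * 2 from rfl, pow_mul (Real.sqrt _),
      Real.sq_sqrt (by positivity)]
    ring
  rw [h1, div_pow, ← mul_div_assoc]
  gcongr 1
  have h2 := pi_sq_lt_sqrt_radicand_mul hk
  have h3 := pi_sq_le_ellipticK_sq hk'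
  linarith

theorem contDiffOn_cnoidalA :
    ContDiffOn ℝ ∞ (fun p : ℝ × ℝ => cnoidalA p.1 p.2) (Ioo (-1) 1 ×ˢ Ioi 0) := by
  have hK : ContDiffOn ℝ ∞ (fun p : ℝ × ℝ => ellipticK p.1) (Ioo (-1) 1 ×ˢ Ioi 0) :=
    contDiffOn_ellipticK.comp contDiffOn_fst fun p hp => hp.1
  have hR : ContDiffOn ℝ ∞ (fun p : ℝ × ℝ => Real.sqrt (p.1 ^ 4 - p.1 ^ 2 + 1))
      (Ioo (-1) 1 ×ˢ Ioi 0) := (contDiff_sqrt_radicand.comp contDiff_fst).contDiffOn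
  unfold cnoidalA
  refine ContDiffOn.mul (contDiffOn_const.div contDiffOn_snd fun p hp => (mem_Ioi.1 hp.2).ne')
    (ContDiffOn.rpow_const_of_ne (by fun_prop) fun p hp =>
      (cnoidalA_radicand_pos hp.2 hp.1).ne')

theorem contDiffOn_cnoidalOmega :
    ContDiffOn ℝ ∞ (fun p : ℝ × ℝ => cnoidalOmega p.1 p.2) (Ioo (-1) 1 ×ˢ Ioi 0) := by
  have hK : ContDiffOn ℝ ∞ (fun p : ℝ × ℝ => ellipticK p.1) (Ioo (-1) 1 ×ˢ Ioi 0) :=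
    contDiffOn_ellipticK.comp contDiffOn_fst fun p hp => hp.1
  have hR : ContDiffOn ℝ ∞ (fun p : ℝ × ℝ => Real.sqrt (p.1 ^ 4 - p.1 ^ 2 + 1))
      (Ioo (-1) 1 ×ˢ Ioi 0) := (contDiff_sqrt_radicand.comp contDiff_fst).contDiffOn
  unfold cnoidalOmega
  exact ContDiffOn.div (by fun_prop) (by fun_prop) fun p hp => (pow_pos (mem_Ioi.1 hp.2) 2).ne'

theorem contDiffOn_cnoidalOmega_left {L : ℝ} (hL : 0 < L) :
    ContDiffOn ℝ ∞ (fun k => cnoidalOmega k L) (Ioo (-1) 1) :=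
  contDiffOn_cnoidalOmega.comp (f := fun k : ℝ => (k, L)) (by fun_prop) fun _ hk => ⟨hk, hL⟩

/-- The frequency has positive derivative: by `ellipticK_le_mul_ellipticP` one has
`K' / K ≥ k / (2 - k²)`, and `2 (k⁴ - k² + 1) + (2 k² - 1) (2 - k²) = 3 k²`. -/
theorem exists_pos_hasDerivAt_cnoidalOmega {k L : ℝ} (hL : 0 < L) (hk : k ∈ Ioo (0 : ℝ) 1) :
    ∃ d, 0 < d ∧ HasDerivAt (fun k => cnoidalOmega k L) d k := by
  have hk' := Ioo_zero_one_subset hk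
  have hR0 := Real.sqrt_pos.2 (radicand_pos k)
  have hRsq := Real.sq_sqrt (radicand_pos k).le
  have hR : HasDerivAt (fun k : ℝ => Real.sqrt (k ^ 4 - k ^ 2 + 1))
      ((4 * k ^ 3 - 2 * k) / (2 * Real.sqrt (k ^ 4 - k ^ 2 + 1))) k := by
    refine HasDerivAt.sqrt ?_ (radicand_pos k).ne'
    have := ((hasDerivAt_pow 4 k).sub (hasDerivAt_pow 2 k)).add_const 1
    refine this.congr_deriv ?_
    norm_num
  have h := ((((hasDerivAt_ellipticK hk').pow 2).const_mul 16).mul hR).div_const (L ^ 2)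
  refine ⟨_, div_pos ?_ (pow_pos hL 2), h⟩
  have hK := ellipticK_pos hk'
  have hKP := ellipticK_le_mul_ellipticP hk'
  have hk0 := hk.1
  have hk2 : k ^ 2 < 1 := by nlinarith [hk.1, hk.2]
  set R := Real.sqrt (k ^ 4 - k ^ 2 + 1)
  set K := ellipticK k
  set P := ellipticP k
  have hmain : 0 < 2 * R ^ 2 * P + (2 * k ^ 2 - 1) * K := by
    have h1 : 0 < (2 - k ^ 2) * (2 * R ^ 2 * P + (2 * k ^ 2 - 1) * K) := by
      have h2 : 2 * R ^ 2 * K ≤ 2 * R ^ 2 * ((2 - k ^ 2) * P) := by gcongr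
      have h3 : 0 < 3 * k ^ 2 * K := by positivity
      rw [hRsq] at h2 ⊢
      nlinarith
    exact pos_of_mul_pos_right h1 (by linarith)
  have : 16 * K ^ 2 * ((4 * k ^ 3 - 2 * k) / (2 * R)) + 16 * (2 * K * (k * P)) * R
      = 16 * K * k / R * (2 * R ^ 2 * P + (2 * k ^ 2 - 1) * K) := by
    field_simp
    ring
  have h4 : 0 < 16 * K * k / R * (2 * R ^ 2 * P + (2 * k ^ 2 - 1) * K) := by positivity
  rw [← this] at h4
  convert! h4 using 1
  simp
  ring

theorem bijOn_cnoidalOmega {L : ℝ} (hL : 0 < L) :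
    BijOn (fun k => cnoidalOmega k L) (Ioo 0 1) (Ioi (4 * Real.pi ^ 2 / L ^ 2)) := by
  have hcont : ContinuousOn (fun k => cnoidalOmega k L) (Ioo (-1) 1) :=
    (contDiffOn_cnoidalOmega_left hL).continuousOn
  refine ⟨fun k hk => cnoidalOmega_mem hL hk, StrictMonoOn.injOn ?_, ?_⟩
  · refine strictMonoOn_of_deriv_pos (convex_Ioo 0 1) (hcont.mono Ioo_zero_one_subset)
      fun k hk => ?_
    rw [interior_Ioo] at hk
    obtain ⟨d, hd, hd'⟩ := exists_pos_hasDerivAt_cnoidalOmega hL hk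
    rwa [hd'.deriv]
  · intro v hv
    -- a modulus for which `K ≥ M` is so large that `ω > v`
    let M : ℝ := 1 + |v| * L ^ 2
    have hM : 1 ≤ M := by
      have : 0 ≤ |v| * L ^ 2 := by positivity
      simp only [M]
      linarith
    let k := Real.sqrt (1 - Real.exp (-M) ^ 2)
    have hexp : Real.exp (-M) < 1 := by
      rw [Real.exp_lt_one_iff]
      linarith
    have hexp0 := Real.exp_pos (-M)
    have hpos : 0 < 1 - Real.exp (-M) ^ 2 := by nlinarith
    have hksq : k ^ 2 = 1 - Real.exp (-M) ^ 2 := Real.sq_sqrt hpos.le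
    have hk : k ∈ Ioo (0 : ℝ) 1 := by
      refine ⟨Real.sqrt_pos.2 hpos, ?_⟩
      rw [Real.sqrt_lt' one_pos]
      nlinarith
    have hKM : M ≤ ellipticK k := by
      have := neg_log_sqrt_le_ellipticK (Ioo_zero_one_subset hk)
      rwa [hksq, sub_sub_cancel, Real.sqrt_sq hexp0.le, Real.log_exp, neg_neg] at this
    have hR : 1 / 2 < Real.sqrt (k ^ 4 - k ^ 2 + 1) := by
      have := one_sub_half_sq_lt_sqrt_radicand hk
      have h2 : k ^ 2 < 1 := by nlinarith [hk.1, hk.2]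
      linarith
    have hlarge : v < cnoidalOmega k L := by
      rw [cnoidalOmega, lt_div_iff₀ (by positivity)]
      have h1 : v * L ^ 2 ≤ |v| * L ^ 2 := by gcongr; exact le_abs_self v
      have h2 : M ≤ ellipticK k ^ 2 := by nlinarith
      have h3 : 0 < ellipticK k ^ 2 := by linarith
      simp only [M] at h2
      nlinarith
    have h0 : cnoidalOmega 0 L = 4 * Real.pi ^ 2 / L ^ 2 := by
      rw [cnoidalOmega, ellipticK_zero]
      norm_num
      ring
    have hsub : Icc 0 k ⊆ Ioo (-1 : ℝ) 1 := fun x hx =>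
      ⟨by linarith [hx.1], hx.2.trans_lt hk.2⟩
    obtain ⟨l, hl, hlv⟩ := intermediate_value_Ioo hk.1.le (hcont.mono hsub)
      (show v ∈ Ioo (cnoidalOmega 0 L) (cnoidalOmega k L) from ⟨h0 ▸ hv, hlarge⟩)
    exact ⟨l, ⟨hl.1, hl.2.trans hk.2⟩, hlv⟩

end Parameters

/-! ### The differential equation -/

section Equation

open Filter Topology

/-- The normalized profile `cn(u, k) / √(1 - q sn²(u, k))`, of period `4 K(k)` in `u`. -/
noncomputable def normalizedProfile (k u : ℝ) : ℝ :=
  jacobiCn u k / Real.sqrt (1 - cnoidalQ k * jacobiSn u k ^ 2)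

theorem cnoidalQ_neg {k : ℝ} (hk : k ∈ Ioo (-1 : ℝ) 1) : cnoidalQ k < 0 := by
  have hk2 : k ^ 2 < 1 := by
    rw [sq_lt_one_iff_abs_lt_one, abs_lt]
    exact hk
  unfold cnoidalQ
  linarith [Real.sqrt_nonneg (k ^ 4 - k ^ 2 + 1)]

theorem one_sub_cnoidalQ_mul_sq_pos {k : ℝ} (hk : k ∈ Ioo (-1 : ℝ) 1) (s : ℝ) :
    0 < 1 - cnoidalQ k * s ^ 2 := by
  nlinarith [mul_nonneg (neg_nonneg.2 (cnoidalQ_neg hk).le) (sq_nonneg s)]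

/-- The derivative of `normalizedProfile k`, that is `-(1 - q) sn dn / (1 - q sn²)^{3/2}`. -/
noncomputable def normalizedProfileDeriv (k u : ℝ) : ℝ :=
  -(1 - cnoidalQ k) * (jacobiSn u k * Real.sqrt (1 - k ^ 2 * jacobiSn u k ^ 2)) /
    Real.sqrt (1 - cnoidalQ k * jacobiSn u k ^ 2) ^ 3

theorem hasDerivAt_jacobiSn {k : ℝ} (hk : k ∈ Ioo (-1 : ℝ) 1) (u : ℝ) :
    HasDerivAt (fun u => jacobiSn u k)
      (jacobiCn u k * Real.sqrt (1 - k ^ 2 * jacobiSn u k ^ 2)) u :=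
  (hasDerivAt_jacobiAm hk u).sin

theorem hasDerivAt_jacobiCn {k : ℝ} (hk : k ∈ Ioo (-1 : ℝ) 1) (u : ℝ) :
    HasDerivAt (fun u => jacobiCn u k)
      (-jacobiSn u k * Real.sqrt (1 - k ^ 2 * jacobiSn u k ^ 2)) u :=
  (hasDerivAt_jacobiAm hk u).cos

theorem hasDerivAt_sqrt_one_sub_mul_jacobiSn_sq {k c : ℝ} (hk : k ∈ Ioo (-1 : ℝ) 1) (u : ℝ)
    (hc : 0 < 1 - c * jacobiSn u k ^ 2) :
    HasDerivAt (fun u => Real.sqrt (1 - c * jacobiSn u k ^ 2))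
      (-(c * jacobiSn u k * jacobiCn u k * Real.sqrt (1 - k ^ 2 * jacobiSn u k ^ 2)) /
        Real.sqrt (1 - c * jacobiSn u k ^ 2)) u := by
  have h := ((((hasDerivAt_jacobiSn hk u).pow 2).const_mul c).const_sub 1).sqrt hc.ne'
  refine h.congr_deriv ?_
  have := Real.sqrt_pos.2 hc
  simp only [Pi.pow_apply]
  field_simp
  norm_num
  ring

theorem hasDerivAt_normalizedProfile {k : ℝ} (hk : k ∈ Ioo (-1 : ℝ) 1) (u : ℝ) :
    HasDerivAt (normalizedProfile k) (normalizedProfileDeriv k u) u := by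
  have hD := one_sub_cnoidalQ_mul_sq_pos hk (jacobiSn u k)
  have hS := Real.sqrt_pos.2 hD
  have hSsq := Real.sq_sqrt hD.le
  have h := (hasDerivAt_jacobiCn hk u).div (hasDerivAt_sqrt_one_sub_mul_jacobiSn_sq hk u hD) hS.ne'
  refine h.congr_deriv ?_
  have htrig : jacobiSn u k ^ 2 + jacobiCn u k ^ 2 = 1 := Real.sin_sq_add_cos_sq _
  rw [normalizedProfileDeriv]
  generalize Real.sqrt (1 - k ^ 2 * jacobiSn u k ^ 2) = d
  generalize Real.sqrt (1 - cnoidalQ k * jacobiSn u k ^ 2) = S at *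
  generalize jacobiSn u k = s at *
  generalize jacobiCn u k = c at *
  generalize cnoidalQ k = q at *
  field_simp
  rw [hSsq]
  linear_combination s * d * q * htrig

/-- The normalized profile solves `f'' = R f - (2 - k² + 2 R) f⁵`, where `R = √(k⁴ - k² + 1)`. -/
theorem hasDerivAt_normalizedProfileDeriv {k : ℝ} (hk : k ∈ Ioo (-1 : ℝ) 1) (u : ℝ) :
    HasDerivAt (normalizedProfileDeriv k)
      (Real.sqrt (k ^ 4 - k ^ 2 + 1) * normalizedProfile k u -
        (2 - k ^ 2 + 2 * Real.sqrt (k ^ 4 - k ^ 2 + 1)) * normalizedProfile k u ^ 5) u := by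
  have hD := one_sub_cnoidalQ_mul_sq_pos hk (jacobiSn u k)
  have hS := Real.sqrt_pos.2 hD
  have hSsq := Real.sq_sqrt hD.le
  have hE : 0 < 1 - k ^ 2 * jacobiSn u k ^ 2 := one_sub_sq_mul_sin_sq_pos hk _
  have hd := Real.sqrt_pos.2 hE
  have hdsq := Real.sq_sqrt hE.le
  have h := (((hasDerivAt_jacobiSn hk u).mul
    (hasDerivAt_sqrt_one_sub_mul_jacobiSn_sq hk u hE)).const_mul (-(1 - cnoidalQ k))).div
    ((hasDerivAt_sqrt_one_sub_mul_jacobiSn_sq hk u hD).pow 3) (pow_pos hS 3).ne'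
  refine h.congr_deriv ?_
  simp only [Pi.pow_apply, Pi.mul_apply]
  have htrig : jacobiSn u k ^ 2 + jacobiCn u k ^ 2 = 1 := Real.sin_sq_add_cos_sq _
  have hR := Real.sq_sqrt (radicand_pos k).le
  have hq : cnoidalQ k = -1 + k ^ 2 - Real.sqrt (k ^ 4 - k ^ 2 + 1) := rfl
  simp only [normalizedProfile]
  generalize Real.sqrt (1 - k ^ 2 * jacobiSn u k ^ 2) = d at *
  generalize Real.sqrt (1 - cnoidalQ k * jacobiSn u k ^ 2) = S at *
  generalize jacobiSn u k = s at *
  generalize jacobiCn u k = c at *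
  generalize cnoidalQ k = q at *
  generalize Real.sqrt (k ^ 4 - k ^ 2 + 1) = R at *
  -- the two sides agree as polynomials in `s²`, up to a multiple of `R² - (k⁴ - k² + 1)`
  have key : -(1 - q) * c * ((d ^ 2 - k ^ 2 * s ^ 2) * S ^ 2 + 3 * q * s ^ 2 * d ^ 2)
      = R * c * S ^ 4 - (2 - k ^ 2 + 2 * R) * c ^ 5 := by
    have hc4 : c ^ 5 = c * (1 - s ^ 2) ^ 2 := by
      rw [← htrig]
      ring
    rw [show S ^ 4 = (S ^ 2) ^ 2 by ring, hSsq, hdsq, hc4, hq]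
    linear_combination (-c * s ^ 4 * (R + 2 - k ^ 2)) * hR
  have hl : ∀ A B : ℝ, A = B / S ^ 5 → B = R * c * S ^ 4 - (2 - k ^ 2 + 2 * R) * c ^ 5 →
      A = R * (c / S) - (2 - k ^ 2 + 2 * R) * (c / S) ^ 5 := by
    rintro A B rfl rfl
    field_simp
  refine hl _ _ ?_ key
  field_simp
  push_cast
  ring

theorem cnoidalWave_eq (κ γ B L k x : ℝ) : cnoidalWave κ γ B L k x =
    1 / (κ + γ * B ^ 3) ^ (1 / 4 : ℝ) * cnoidalA k L *
      normalizedProfile k (4 * ellipticK k / L * x) := by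
  rw [cnoidalWave, normalizedProfile]
  ring

/-- The wave is jointly smooth in the modulus and the space variable. -/
theorem contDiffOn_cnoidalWave (κ γ B : ℝ) {L : ℝ} (hL : 0 < L) :
    ContDiffOn ℝ ∞ (fun p : ℝ × ℝ => cnoidalWave κ γ B L p.1 p.2) (Ioo (-1) 1 ×ˢ univ) := by
  have hK : ContDiffOn ℝ ∞ (fun p : ℝ × ℝ => ellipticK p.1) (Ioo (-1) 1 ×ˢ univ) :=
    contDiffOn_ellipticK.comp contDiffOn_fst fun p hp => hp.1
  have hA : ContDiffOn ℝ ∞ (fun p : ℝ × ℝ => cnoidalA p.1 L) (Ioo (-1) 1 ×ˢ univ) :=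
    contDiffOn_cnoidalA.comp (f := fun p : ℝ × ℝ => (p.1, L)) (by fun_prop)
      fun p hp => ⟨hp.1, hL⟩
  have hq : ContDiffOn ℝ ∞ (fun p : ℝ × ℝ => cnoidalQ p.1) (Ioo (-1) 1 ×ˢ univ) :=
    (contDiff_cnoidalQ.comp contDiff_fst).contDiffOn
  have ham : ContDiffOn ℝ ∞ (fun p : ℝ × ℝ => jacobiAm (4 * ellipticK p.1 / L * p.2) p.1)
      (Ioo (-1) 1 ×ˢ univ) :=
    contDiffOn_jacobiAm.comp (f := fun p : ℝ × ℝ => (4 * ellipticK p.1 / L * p.2, p.1))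
      (by fun_prop) fun p hp => ⟨mem_univ _, hp.1⟩
  unfold cnoidalWave jacobiCn jacobiSn
  refine contDiffOn_const.mul (ContDiffOn.div (hA.mul ham.cos) (ContDiffOn.sqrt ?_ ?_) ?_)
  · exact contDiffOn_const.sub (hq.mul (ham.sin.pow 2))
  · exact fun p hp => (one_sub_cnoidalQ_mul_sq_pos hp.1 _).ne'
  · exact fun p hp => (Real.sqrt_pos.2 (one_sub_cnoidalQ_mul_sq_pos hp.1 _)).ne'

theorem cnoidalWave_periodic (κ γ B : ℝ) {L k : ℝ} (hL : 0 < L) (hk : k ∈ Ioo (-1 : ℝ) 1) :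
    Function.Periodic (cnoidalWave κ γ B L k) L := by
  intro x
  have : 4 * ellipticK k / L * (x + L) = 4 * ellipticK k / L * x + 4 * ellipticK k := by
    field_simp
  simp only [cnoidalWave, jacobiCn, jacobiSn, this, jacobiAm_add_four_mul_ellipticK hk,
    Real.cos_add_two_pi, Real.sin_add_two_pi]

theorem isPeriodicSolution_cnoidalWave {κ γ B L k : ℝ} (hc : 0 < κ + γ * B ^ 3) (hL : 0 < L)
    (hk : k ∈ Ioo (-1 : ℝ) 1) :
    IsPeriodicSolution κ γ B L (cnoidalOmega k L) (cnoidalWave κ γ B L k) := by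
  refine ⟨cnoidalWave_periodic κ γ B hL hk, ?_, fun x => ?_⟩
  · rw [← contDiffOn_univ]
    exact ((contDiffOn_cnoidalWave κ γ B hL).of_le ENat.LEInfty.out).comp
      (f := fun x : ℝ => (k, x)) (by fun_prop) fun x _ => ⟨hk, mem_univ _⟩
  · -- `φ = C f(b x)`, where `b² R = ω` and `(κ + γ B³) C⁴ = (2 - k² + 2 R) b²`
    set b := 4 * ellipticK k / L with hb
    set C := 1 / (κ + γ * B ^ 3) ^ (1 / 4 : ℝ) * cnoidalA k L with hC
    have hwave : cnoidalWave κ γ B L k = fun x => C * normalizedProfile k (b * x) :=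
      funext fun x => cnoidalWave_eq κ γ B L k x
    have hlin : ∀ x : ℝ, HasDerivAt (fun x => b * x) b x := fun x => by
      simpa using (hasDerivAt_id x).const_mul b
    have h1 : deriv (cnoidalWave κ γ B L k) = fun x => C * (normalizedProfileDeriv k (b * x) * b) := by
      rw [hwave]
      funext x
      exact (((hasDerivAt_normalizedProfile hk (b * x)).comp x (hlin x)).const_mul C).deriv
    have h2 := ((((hasDerivAt_normalizedProfileDeriv hk (b * x)).comp x
      (hlin x)).mul_const b).const_mul C).deriv
    have hC4 : (κ + γ * B ^ 3) * C ^ 4 =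
        (2 - k ^ 2 + 2 * Real.sqrt (k ^ 4 - k ^ 2 + 1)) * b ^ 2 := by
      have h4 : ((κ + γ * B ^ 3) ^ (1 / 4 : ℝ)) ^ 4 = κ + γ * B ^ 3 := by
        rw [← Real.rpow_natCast, ← Real.rpow_mul hc.le]
        norm_num
      rw [hC, mul_pow, cnoidalA_pow_four hL hk, div_pow, h4, one_pow, ← hb, ← mul_assoc,
        mul_one_div_cancel hc.ne', one_mul]
    have hom : cnoidalOmega k L = b ^ 2 * Real.sqrt (k ^ 4 - k ^ 2 + 1) := by
      rw [cnoidalOmega, hb]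
      ring
    rw [h1]
    simp only [Function.comp_def] at h2
    rw [h2, hwave, hom]
    linear_combination (-C * normalizedProfile k (b * x) ^ 5) * hC4

end Equation

/-! ### Smooth families of periodic functions in the Sobolev space -/

section SobolevCurves

open Filter Topology AddCircle

theorem isOpenQuotientMap_coe_addCircle (T : ℝ) :
    IsOpenQuotientMap ((↑) : ℝ → AddCircle T) :=
  QuotientAddGroup.isOpenQuotientMap_mk

theorem Function.Periodic.of_hasDerivAt {T : ℝ} {u v : ℝ → ℝ} (hu : Function.Periodic u T)
    (h : ∀ x, HasDerivAt u (v x) x) : Function.Periodic v T := by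
  intro x
  have h1 := (h (x + T)).comp_add_const x T
  rw [show (fun x => u (x + T)) = u from funext hu] at h1
  exact h1.unique (h x)

theorem exists_continuousMap_addCircle {T : ℝ} {f : ℝ → ℂ} (hf : Continuous f)
    (hp : Function.Periodic f T) : ∃ c : C(AddCircle T, ℂ), ∀ x : ℝ, c x = f x := by
  refine ⟨⟨hp.lift, ?_⟩, fun x => hp.lift_coe x⟩
  rw [(isOpenQuotientMap_coe_addCircle T).isQuotientMap.continuous_iff]
  exact hf

variable {L : ℝ} [hL : Fact (0 < L)]

theorem ae_coe_addCircle_of_ae {P : AddCircle L → Prop}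
    (h : ∀ᵐ y ∂(haarAddCircle (T := L)), P y) : ∀ᵐ x : ℝ, P (x : AddCircle L) := by
  have hv : ∀ᵐ y : AddCircle L, P y := by
    rw [volume_eq_smul_haarAddCircle]
    exact Measure.ae_smul_measure h _
  have hn : ∀ n : ℤ, ∀ᵐ x : ℝ ∂(volume.restrict (Ioc (0 + n • L) (0 + (n + 1) • L))),
      P (x : AddCircle L) := by
    intro n
    have := (AddCircle.measurePreserving_mk L (0 + n • L)).quasiMeasurePreserving.ae hv
    rwa [show 0 + n • L + L = 0 + (n + 1) • L by rw [add_zsmul, one_zsmul, add_assoc]] at this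
  rw [← ae_restrict_iUnion_iff, iUnion_Ioc_add_zsmul hL.out, Measure.restrict_univ] at hn
  exact hn

/-- Integration by parts on the circle: differentiating twice multiplies the Fourier coefficients
by `-(2πn/L)²`. -/
theorem fourierCoeff_of_hasDerivAt_of_hasDerivAt {f f₂ : AddCircle L → ℂ} {g g₁ g₂ : ℝ → ℂ}
    (hg : ∀ x, HasDerivAt g (g₁ x) x) (hg₁ : ∀ x, HasDerivAt g₁ (g₂ x) x) (hc : Continuous g₂)
    (hp : Function.Periodic g L) (hp₁ : Function.Periodic g₁ L)
    (hf : ∀ x : ℝ, f x = g x) (hf₂ : ∀ x : ℝ, f₂ x = g₂ x) (n : ℤ) :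
    fourierCoeff f₂ n = -(2 * Real.pi * n / L) ^ 2 * fourierCoeff f n := by
  set e : ℝ → ℂ := fun x => fourier (-n) (x : AddCircle L) with he
  set z : ℂ := -2 * Real.pi * Complex.I * n / L with hz
  have hder : ∀ x, HasDerivAt e (z * e x) x := fun x => hasDerivAt_fourier_neg L n x
  have hce : Continuous e := continuous_iff_continuousAt.2 fun x => (hder x).continuousAt
  have hcg : Continuous g := continuous_iff_continuousAt.2 fun x => (hg x).continuousAt
  have hep : Function.Periodic e L := fun x => by
    simp only [he]
    rw [AddCircle.coe_add_period]
  have hW : ∀ x, HasDerivAt (fun x => e x * g₁ x - z * e x * g x)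
      (e x * g₂ x - z ^ 2 * (e x * g x)) x := by
    intro x
    have := ((hder x).mul (hg₁ x)).sub (((hder x).const_mul z).mul (hg x))
    refine this.congr_deriv ?_
    ring
  have hint := intervalIntegral.integral_eq_sub_of_hasDerivAt (a := 0) (b := 0 + L)
    (fun x _ => hW x) ((by fun_prop : Continuous _).intervalIntegrable _ _)
  rw [hep 0, hp 0, hp₁ 0, sub_self, intervalIntegral.integral_sub
    ((by fun_prop : Continuous _).intervalIntegrable _ _)
    ((by fun_prop : Continuous _).intervalIntegrable _ _),
    intervalIntegral.integral_const_mul, sub_eq_zero] at hint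
  have hz2 : z ^ 2 = -(2 * Real.pi * n / L) ^ 2 := by
    rw [hz, div_pow, div_pow]
    linear_combination (4 * Real.pi ^ 2 * n ^ 2 / L ^ 2 : ℂ) * Complex.I_sq
  rw [fourierCoeff_eq_intervalIntegral _ n 0, fourierCoeff_eq_intervalIntegral _ n 0]
  simp only [hf, hf₂, smul_eq_mul]
  rw [hint, hz2, mul_smul_comm]

/-- The map `f ↦ (√L (1 + n²) f̂(n))ₙ` is onto `ℓ²`. -/
theorem H2per.toEll2_surjective : Function.Surjective (H2per.toEll2 L) := by
  intro c
  have hs : 0 < Real.sqrt L := Real.sqrt_pos.2 hL.out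
  let d : ℤ → ℂ := fun n => ((Real.sqrt L * (1 + (n : ℝ) ^ 2) : ℝ) : ℂ)⁻¹ * c n
  have hd : Memℓp d 2 := by
    have h1 : Memℓp (fun n => ((Real.sqrt L : ℝ) : ℂ)⁻¹ • c n) 2 :=
      c.2.const_smul ((Real.sqrt L : ℝ) : ℂ)⁻¹
    rw [memℓp_gen_iff (by norm_num)] at h1 ⊢
    refine h1.of_nonneg_of_le (fun n => by positivity) fun n => ?_
    refine Real.rpow_le_rpow (norm_nonneg _) ?_ (by norm_num)
    simp only [d, smul_eq_mul, norm_mul, norm_inv, Complex.norm_real]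
    refine mul_le_mul_of_nonneg_right ?_ (norm_nonneg _)
    rw [Real.norm_of_nonneg (by positivity), Real.norm_of_nonneg (by positivity)]
    refine inv_anti₀ hs ?_
    nlinarith [sq_nonneg (n : ℝ)]
  let f : L2per L := (fourierBasis (T := L)).repr.symm ⟨d, hd⟩
  have hf : h2Coeff f = c := by
    funext n
    have h1 : fourierCoeff f n = d n := by
      rw [← fourierBasis_repr, LinearIsometryEquiv.apply_symm_apply]
    rw [h2Coeff, h1, mul_inv_cancel_left₀]
    rw [Complex.ofReal_ne_zero]
    positivity
  refine ⟨⟨f, ?_⟩, ?_⟩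
  · change Memℓp (h2Coeff f) 2
    rw [hf]
    exact c.2
  · exact Subtype.ext hf

variable (L) in
/-- The space `H²_per` is isometric to `ℓ²`, through the weighted Fourier coefficients. -/
noncomputable def H2per.ell2Equiv : H2per L ≃ₗᵢ[ℂ] lp (fun _ : ℤ => ℂ) 2 where
  toLinearEquiv := LinearEquiv.ofBijective (H2per.toEll2 L)
    ⟨H2per.toEll2_injective L, H2per.toEll2_surjective⟩
  norm_map' _ := rfl

variable (L) in
/-- The continuous linear map `C(ℝ/Lℤ) → H²_per` which divides the `n`-th Fourier coefficient
by `√L (1 + n²)`. -/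
noncomputable def H2per.ofContinuous : C(AddCircle L, ℂ) →L[ℝ] H2per L :=
  (((fourierBasis (T := L)).repr.trans (H2per.ell2Equiv L).symm).toContinuousLinearEquiv
    |>.toContinuousLinearMap.comp (ContinuousMap.toLp 2 haarAddCircle ℂ)).restrictScalars ℝ

theorem H2per.h2Coeff_ofContinuous (c : C(AddCircle L, ℂ)) (n : ℤ) :
    h2Coeff (H2per.ofContinuous L c).toL2 n = fourierCoeff c n := by
  have h1 : H2per.ell2Equiv L (H2per.ofContinuous L c) =
      (fourierBasis (T := L)).repr (ContinuousMap.toLp 2 haarAddCircle ℂ c) := by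
    rw [show H2per.ofContinuous L c = (H2per.ell2Equiv L).symm
      ((fourierBasis (T := L)).repr (ContinuousMap.toLp 2 haarAddCircle ℂ c)) from rfl,
      LinearIsometryEquiv.apply_symm_apply]
  have h2 := congrFun (congrArg Subtype.val h1) n
  rw [fourierBasis_repr, fourierCoeff_toLp] at h2
  exact h2

/-- A periodic `C²` function `φ` is recovered from the continuous function
`√L (φ - (L/2π)² φ'')`, whose Fourier coefficients are `√L (1 + n²) φ̂(n)`. -/
theorem H2per.isClassOf_ofContinuous {φ : ℝ → ℝ} {g₁ g₂ : ℝ → ℝ} (hg : ∀ x, HasDerivAt φ (g₁ x) x)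
    (hg₁ : ∀ x, HasDerivAt g₁ (g₂ x) x) (hc : Continuous g₂) (hp : Function.Periodic φ L)
    {c : C(AddCircle L, ℂ)}
    (h : ∀ x : ℝ, c x = ((Real.sqrt L * (φ x - (L / (2 * Real.pi)) ^ 2 * g₂ x) : ℝ) : ℂ)) :
    (H2per.ofContinuous L c).IsClassOf φ := by
  have hp₁ := hp.of_hasDerivAt hg
  have hp₂ := hp₁.of_hasDerivAt hg₁
  have hcφ : Continuous φ := continuous_iff_continuousAt.2 fun x => (hg x).continuousAt
  obtain ⟨f, hf⟩ := exists_continuousMap_addCircle (T := L)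
    (f := fun x => (φ x : ℂ)) (by fun_prop) fun x => by simp [hp x]
  obtain ⟨f₂, hf₂⟩ := exists_continuousMap_addCircle (T := L)
    (f := fun x => (g₂ x : ℂ)) (by fun_prop) fun x => by simp [hp₂ x]
  have hcoe : (H2per.ofContinuous L c).toL2 = ContinuousMap.toLp 2 haarAddCircle ℂ f := by
    apply (fourierBasis (T := L)).repr.injective
    ext n
    rw [fourierBasis_repr, fourierBasis_repr, fourierCoeff_toLp]
    have h1 := H2per.h2Coeff_ofContinuous c n
    have h2 : c = ((Real.sqrt L : ℝ) : ℂ) • (f - (((L / (2 * Real.pi)) ^ 2 : ℝ) : ℂ) • f₂) := by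
      ext y
      obtain ⟨x, rfl⟩ := (isOpenQuotientMap_coe_addCircle L).surjective y
      simp only [ContinuousMap.smul_apply, ContinuousMap.sub_apply, hf, hf₂, h, smul_eq_mul]
      push_cast
      ring
    have h3 : fourierCoeff c n = ((Real.sqrt L : ℝ) : ℂ) *
        (fourierCoeff f n - (((L / (2 * Real.pi)) ^ 2 : ℝ) : ℂ) * fourierCoeff f₂ n) := by
      rw [← fourierCoeff_toLp, ← fourierCoeff_toLp, ← fourierCoeff_toLp, h2]
      simp only [← fourierBasis_repr, map_sub, map_smul, lp.coeFn_sub, lp.coeFn_smul,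
        Pi.sub_apply, Pi.smul_apply, smul_eq_mul]
    have h4 := fourierCoeff_of_hasDerivAt_of_hasDerivAt (L := L) (f := f) (f₂ := f₂)
      (fun x => (hg x).ofReal_comp) (fun x => (hg₁ x).ofReal_comp) (by fun_prop)
      (fun x => by simp [hp x]) (fun x => by simp [hp₁ x]) hf hf₂ n
    have hs : 0 < Real.sqrt L := Real.sqrt_pos.2 hL.out
    have hne : ((Real.sqrt L * (1 + (n : ℝ) ^ 2) : ℝ) : ℂ) ≠ 0 := by
      rw [Complex.ofReal_ne_zero]
      positivity
    refine mul_left_cancel₀ hne ?_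
    rw [h2Coeff] at h1
    rw [h1, h3, h4]
    have hLne : (L : ℂ) ≠ 0 := Complex.ofReal_ne_zero.2 hL.out.ne'
    have hpi : (Real.pi : ℂ) ≠ 0 := Complex.ofReal_ne_zero.2 Real.pi_ne_zero
    push_cast
    field_simp
    ring
  have hae : ∀ᵐ y ∂(haarAddCircle (T := L)), (H2per.ofContinuous L c).toL2 y = f y := by
    rw [hcoe]
    exact ContinuousMap.coeFn_toLp _ f
  filter_upwards [ae_coe_addCircle_of_ae hae] with x hx
  rw [hx, hf]

/-- The partial derivative in the second variable of a jointly smooth function. -/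
theorem exists_contDiffOn_hasDerivAt_snd {U : Set ℝ} (hU : IsOpen U) {F : ℝ × ℝ → ℝ}
    (hF : ContDiffOn ℝ ∞ F (U ×ˢ univ)) :
    ∃ F' : ℝ × ℝ → ℝ, ContDiffOn ℝ ∞ F' (U ×ˢ univ) ∧
      ∀ w ∈ U, ∀ x, HasDerivAt (fun x => F (w, x)) (F' (w, x)) x := by
  have hUo : IsOpen (U ×ˢ (univ : Set ℝ)) := hU.prod isOpen_univ
  refine ⟨fun p => fderiv ℝ F p (0, 1),
    (hF.fderiv_of_isOpen hUo (by simp)).clm_apply contDiffOn_const, fun w hw x => ?_⟩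
  have h1 : HasFDerivAt F (fderiv ℝ F (w, x)) (w, x) :=
    ((hF.differentiableOn (by simp)).differentiableAt
      (hUo.mem_nhds ⟨hw, mem_univ x⟩)).hasFDerivAt
  exact h1.comp_hasDerivAt x ((hasDerivAt_const x w).prodMk (hasDerivAt_id x))

/-- A jointly smooth family of periodic functions is a smooth curve in `H²_per`. -/
theorem exists_contDiffOn_isClassOf {U : Set ℝ} (hU : IsOpen U) {F : ℝ × ℝ → ℝ}
    (hF : ContDiffOn ℝ ∞ F (U ×ˢ univ))
    (hp : ∀ w ∈ U, Function.Periodic (fun x => F (w, x)) L) :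
    ∃ Φ : ℝ → H2per L, ContDiffOn ℝ ∞ Φ U ∧ ∀ w ∈ U, (Φ w).IsClassOf fun x => F (w, x) := by
  obtain ⟨F₁, hF₁, hd₁⟩ := exists_contDiffOn_hasDerivAt_snd hU hF
  obtain ⟨F₂, hF₂, hd₂⟩ := exists_contDiffOn_hasDerivAt_snd hU hF₁
  let G : ℝ × ℝ → ℂ := fun p =>
    ((Real.sqrt L * (F p - (L / (2 * Real.pi)) ^ 2 * F₂ p) : ℝ) : ℂ)
  have hG : ContDiffOn ℝ ∞ G (U ×ˢ univ) :=
    Complex.ofRealCLM.contDiff.comp_contDiffOn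
      (contDiffOn_const.mul (hF.sub (contDiffOn_const.mul hF₂)))
  have hex : ∀ w, ∃ c : C(AddCircle L, ℂ), w ∈ U → ∀ x : ℝ, c x = G (w, x) := by
    intro w
    by_cases hw : w ∈ U
    · have hp₂ := ((hp w hw).of_hasDerivAt (hd₁ w hw)).of_hasDerivAt (hd₂ w hw)
      obtain ⟨c, hc⟩ := exists_continuousMap_addCircle (T := L) (f := fun x => G (w, x))
        (hG.continuousOn.comp_continuous (by fun_prop) fun x => ⟨hw, mem_univ _⟩) (fun x => by
          have h1 := hp w hw x
          have h2 := hp₂ x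
          simp only [G] at h1 h2 ⊢
          rw [h1, h2])
      exact ⟨c, fun _ => hc⟩
    · exact ⟨0, fun h => absurd h hw⟩
  choose c hc using hex
  have hcC : ContDiffOn ℝ ∞ c U := by
    rw [contDiffOn_infty]
    intro n
    exact ContinuousMap.contDiffOn_of_uncurry hU (isOpenQuotientMap_coe_addCircle L)
      (i := id) continuous_id n (hG.of_le ENat.LEInfty.out) fun w hw x => hc w hw x
  refine ⟨fun w => H2per.ofContinuous L (c w),
    (H2per.ofContinuous L).contDiff.comp_contDiffOn hcC, fun w hw => ?_⟩
  refine H2per.isClassOf_ofContinuous (hd₁ w hw) (hd₂ w hw)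
    (hF₂.continuousOn.comp_continuous (by fun_prop) fun x => ⟨hw, mem_univ _⟩) (hp w hw)
    (hc w hw)

end SobolevCurves

/-! ### The modulus as a function of the frequency -/

section Modulus

open Filter Topology

/-- The modulus `k ∈ (0,1)` of frequency `w`, for the period `L`. -/
noncomputable def modulusOfFrequency (L w : ℝ) : ℝ :=
  Function.invFunOn (fun k => cnoidalOmega k L) (Ioo 0 1) w

theorem modulusOfFrequency_mem {L w : ℝ} (hL : 0 < L) (hw : w ∈ Ioi (4 * Real.pi ^ 2 / L ^ 2)) :
    modulusOfFrequency L w ∈ Ioo (0 : ℝ) 1 :=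
  Function.invFunOn_mem ((bijOn_cnoidalOmega hL).surjOn hw)

theorem cnoidalOmega_modulusOfFrequency {L w : ℝ} (hL : 0 < L)
    (hw : w ∈ Ioi (4 * Real.pi ^ 2 / L ^ 2)) :
    cnoidalOmega (modulusOfFrequency L w) L = w :=
  Function.invFunOn_eq (f := fun k => cnoidalOmega k L) ((bijOn_cnoidalOmega hL).surjOn hw)

theorem modulusOfFrequency_cnoidalOmega {L k : ℝ} (hL : 0 < L) (hk : k ∈ Ioo (0 : ℝ) 1) :
    modulusOfFrequency L (cnoidalOmega k L) = k :=
  (bijOn_cnoidalOmega hL).injOn.leftInvOn_invFunOn hk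

theorem contDiffOn_modulusOfFrequency {L : ℝ} (hL : 0 < L) :
    ContDiffOn ℝ ∞ (modulusOfFrequency L) (Ioi (4 * Real.pi ^ 2 / L ^ 2)) := by
  intro w hw
  refine ContDiffAt.contDiffWithinAt ?_
  have hk := modulusOfFrequency_mem hL hw
  have hkw := cnoidalOmega_modulusOfFrequency hL hw
  set k := modulusOfFrequency L w
  obtain ⟨d, hd, hder⟩ := exists_pos_hasDerivAt_cnoidalOmega hL hk
  have hf : ContDiffAt ℝ ∞ (fun k => cnoidalOmega k L) k :=
    (contDiffOn_cnoidalOmega_left hL).contDiffAt (isOpen_Ioo.mem_nhds (Ioo_zero_one_subset hk))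
  have hfe := hder.hasFDerivAt_equiv hd.ne'
  have h0 : (∞ : WithTop ℕ∞) ≠ 0 := by simp
  let g := hf.localInverse hfe h0
  have hinv : ContDiffAt ℝ ∞ g (cnoidalOmega k L) := hf.to_localInverse hfe h0
  have hright : ∀ᶠ v in 𝓝 (cnoidalOmega k L), cnoidalOmega (g v) L = v :=
    (hf.hasStrictFDerivAt' hfe h0).eventually_right_inverse
  have hgk : g (cnoidalOmega k L) = k := hf.localInverse_apply_image hfe h0
  have hmem : ∀ᶠ v in 𝓝 (cnoidalOmega k L), g v ∈ Ioo (0 : ℝ) 1 :=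
    hinv.continuousAt.eventually_mem (by rw [hgk]; exact isOpen_Ioo.mem_nhds hk)
  rw [hkw] at hinv hright hmem
  refine hinv.congr_of_eventuallyEq ?_
  filter_upwards [hright, hmem] with v hv hvm
  rw [← modulusOfFrequency_cnoidalOmega hL hvm, hv]

/-- The wave `φ_ω` is a smooth curve in `H²_per`, as a function of its frequency. -/
theorem exists_contDiffOn_isClassOf_cnoidalWave (L : ℝ) [Fact (0 < L)] (κ γ B : ℝ) :
    ∃ Φ : ℝ → H2per L,
      ContDiffOn ℝ ∞ Φ (Ioi (4 * Real.pi ^ 2 / L ^ 2)) ∧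
      ∀ k ∈ Ioo (0 : ℝ) 1, (Φ (cnoidalOmega k L)).IsClassOf (cnoidalWave κ γ B L k) := by
  have hL : 0 < L := Fact.out
  have hm : ContDiffOn ℝ ∞ (fun p : ℝ × ℝ => modulusOfFrequency L p.1)
      (Ioi (4 * Real.pi ^ 2 / L ^ 2) ×ˢ univ) :=
    (contDiffOn_modulusOfFrequency hL).comp contDiffOn_fst fun p hp => hp.1
  have hF : ContDiffOn ℝ ∞
      (fun p : ℝ × ℝ => cnoidalWave κ γ B L (modulusOfFrequency L p.1) p.2)
      (Ioi (4 * Real.pi ^ 2 / L ^ 2) ×ˢ univ) :=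
    (contDiffOn_cnoidalWave κ γ B hL).comp
      (f := fun p : ℝ × ℝ => (modulusOfFrequency L p.1, p.2)) (hm.prodMk contDiffOn_snd)
      fun p hp => ⟨Ioo_zero_one_subset (modulusOfFrequency_mem hL hp.1), mem_univ _⟩
  have hp : ∀ w ∈ Ioi (4 * Real.pi ^ 2 / L ^ 2),
      Function.Periodic (cnoidalWave κ γ B L (modulusOfFrequency L w)) L := fun w hw =>
    cnoidalWave_periodic κ γ B hL (Ioo_zero_one_subset (modulusOfFrequency_mem hL hw))
  obtain ⟨Φ, hΦ, hcl⟩ := exists_contDiffOn_isClassOf isOpen_Ioi hF hp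
  refine ⟨Φ, hΦ, fun k hk => ?_⟩
  have := hcl _ (cnoidalOmega_mem hL hk)
  simp only [modulusOfFrequency_cnoidalOmega hL hk] at this
  exact this

end Modulus

theorem mainTheorem5 (L : ℝ) [Fact (0 < L)] (κ γ B : ℝ) (hc : 0 < κ + γ * B ^ 3) :
    -- the ranges of the parameters
    (∀ k ∈ Ioo (0 : ℝ) 1,
      cnoidalA k L ∈ Ioi (2 * Real.sqrt (Real.pi / L)) ∧
      cnoidalQ k ∈ Ioo (-2 : ℝ) (-1) ∧
      cnoidalOmega k L ∈ Ioi (4 * Real.pi ^ 2 / L ^ 2)) ∧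
    -- smooth dependence on `k ∈ (0,1)` and on the period
    ContDiffOn ℝ ∞ (fun p : ℝ × ℝ => cnoidalA p.1 p.2) (Ioo 0 1 ×ˢ Ioi 0) ∧
    ContDiffOn ℝ ∞ cnoidalQ (Ioo 0 1) ∧
    ContDiffOn ℝ ∞ (fun p : ℝ × ℝ => cnoidalOmega p.1 p.2) (Ioo 0 1 ×ˢ Ioi 0) ∧
    -- the cnoidal profiles are periodic solutions
    (∀ k ∈ Ioo (0 : ℝ) 1,
      IsPeriodicSolution κ γ B L (cnoidalOmega k L) (cnoidalWave κ γ B L k)) ∧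
    -- every frequency comes from exactly one modulus, so that `φ_ω` is well defined
    BijOn (fun k => cnoidalOmega k L) (Ioo 0 1) (Ioi (4 * Real.pi ^ 2 / L ^ 2)) ∧
    -- `ω ↦ φ_ω` is a smooth curve in `H²_per`
    ∃ Φ : ℝ → H2per L,
      ContDiffOn ℝ ∞ Φ (Ioi (4 * Real.pi ^ 2 / L ^ 2)) ∧
      ∀ k ∈ Ioo (0 : ℝ) 1, (Φ (cnoidalOmega k L)).IsClassOf (cnoidalWave κ γ B L k) := by
  have hL : 0 < L := Fact.out
  have hsub : Ioo (0 : ℝ) 1 ×ˢ Ioi (0 : ℝ) ⊆ Ioo (-1) 1 ×ˢ Ioi 0 :=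
    prod_mono Ioo_zero_one_subset Subset.rfl
  refine ⟨fun k hk => ⟨cnoidalA_mem hL hk, cnoidalQ_mem hk, cnoidalOmega_mem hL hk⟩,
    contDiffOn_cnoidalA.mono hsub, contDiff_cnoidalQ.contDiffOn,
    contDiffOn_cnoidalOmega.mono hsub,
    fun k hk => isPeriodicSolution_cnoidalWave hc hL (Ioo_zero_one_subset hk),
    bijOn_cnoidalOmega hL, exists_contDiffOn_isClassOf_cnoidalWave L κ γ B⟩
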